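/- Notation. Let $G$ be a finite group and $F$ a number field; write $x^g=g^{-1}xg$ and $\widehat M=|M|^{-1}\sum_{m\in M}m$ for a subgroup $M$. For $K\unlhd H\le G$ put $\varepsilon(H,K)=\widehat K\prod_M(1-\widehat M)\in\mathbb{Q}G$, where $M/K$ runs over the minimal nontrivial normal subgroups of $H/K$. A pair $(H,K)$ of subgroups of $G$ is a strong Shoda pair if (i) $K\le H\unlhd N_G(K)$; (ii) $H/K$ is cyclic and a maximal abelian subgroup of $N_G(K)/K$; (iii) $\varepsilon(H,K)\,\varepsilon(H,K)^g=0$ for all $g\in G\setminus N_G(K)$. The group $G$ is strongly monomial if every irreducible complex character of $G$ is induced from a linear character, with kernel $K$, of a subgroup $H$ such that $(H,K)$ is a strong Shoda pair. For a cyclic section $H/K$ of order $k$, let $\mathcal{C}_F(H/K)$ be the set of orbits of the faithful linear characters $\chi:H/K\to F(\zeta_k)^\times$ under $\mathrm{Gal}(F(\zeta_k)/F)$. For $C\in\mathcal{C}_F(H/K)$ and $\chi\in C$ put $\varepsilon_C(H,K)=|H|^{-1}\sum_{h\in H}\mathrm{tr}_{F(\zeta_k)/F}(\chi(hK))\,h^{-1}$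 (independent of the choice of $\chi\in C$), and let $e_C(G,H,K)\in FG$ be the sum of the distinct $G$-conjugates of $\varepsilon_C(H,K)$. The group $N_G(H)\cap N_G(K)$ acts on $\mathcal{C}_F(H/K)$ by $\chi^g(h^gK)=\chi(hK)$; all elements of $\mathcal{C}_F(H/K)$ have the same stabilizer, denoted $E_F(G,H/K)$. Theorem. Let $G$ be a finite group and $F$ a number field. (0) If $G$ is abelian-by-supersolvable, then $G$ is strongly monomial. Assume now that $G$ is strongly monomial. (1) Every primitive central idempotent of $FG$ is of the form $e_C(G,H,K)$ for some strong Shoda pair $(H,K)$ of $G$ and some $C\in\mathcal{C}_F(H/K)$. (2) Conversely, let $(H,K)$ be any strong Shoda pair of $G$, $C\in\mathcal{C}_F(H/K)$, $k=[H:K]$ and $E=E_F(G,H/K)$. Then $e_C(G,H,K)$ is a primitive central idempotent of $FG$, and there is an isomorphism of $F$-algebras $$FG\,e_C(G,H,K)\;\cong\; M_{[G:E]}\bigl(F(\zeta_k)*^{\sigma}_{\tau}E/H\bigr).$$ Here $\zeta_k$ is any primitive $k$-th root of unity, $y\in H$ is any element with $\chi(yK)=\zeta_k$ for some $\chi\in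 C$ (so that $yK$ generates $H/K$), $\phi:E/H\to E/K$ is any map whose composition with the projection $E/K\to E/H$ is the identity, and the action $\sigma$ and the twisting $\tau$ are the well-defined maps determined by $$\sigma_{x}(\zeta_k)=\zeta_k^{i}\ \text{ if }\ \phi(x)^{-1}(yK)\phi(x)=y^{i}K,\qquad \tau(x,x')=\zeta_k^{j}\ \text{ if }\ \phi(xx')^{-1}\phi(x)\phi(x')=y^{j}K$$ for $x,x'\in E/H$ and integers $i,j$, with each $\sigma_x$ an $F$-automorphism of $F(\zeta_k)$. The crossed product $F(\zeta_k)*^\sigma_\tau E/H$ is the $F$-algebra which is a free right $F(\zeta_k)$-module with basis $(u_x)_{x\in E/H}$ and multiplication given by $a\,u_x=u_x\,\sigma_x(a)$ and $u_xu_{x'}=u_{xx'}\,\tau(x,x')$. -/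

import Mathlib

namespace ShodaPairs

/-! ### Classes of groups -/

section Groups

variable {G : Type*} [Group G]

/-- A finite group is supersolvable if it has a chain `1 = N₀ ≤ N₁ ≤ ⋯ ≤ Nₙ = G` of normal
subgroups of `G` with cyclic quotients `Nᵢ₊₁ / Nᵢ` (that is, `Nᵢ₊₁` is generated by `Nᵢ` together
with one element). -/
def IsSupersolvable (G : Type*) [Group G] : Prop :=
  ∃ (n : ℕ) (N : ℕ → Subgroup G), N 0 = ⊥ ∧ N n = ⊤ ∧ (∀ i, (N i).Normal) ∧
    ∀ i < n, ∃ x : G, N (i + 1) = N i ⊔ Subgroup.zpowers x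

/-- `G` has an abelian normal subgroup with supersolvable quotient. -/
def IsAbelianBySupersolvable (G : Type*) [Group G] : Prop :=
  ∃ (A : Subgroup G) (_ : A.Normal), IsMulCommutative A ∧ IsSupersolvable (G ⧸ A)

end Groups

/-! ### Idempotents of group algebras -/

section Idempotents

/-- A primitive central idempotent of a ring: a nonzero central idempotent which is not a sum of
two nonzero orthogonal central idempotents. -/
structure IsPrimitiveCentralIdempotent {R : Type*} [Ring R] (e : R) : Prop where
  idem : IsIdempotentElem e
  central : e ∈ Set.center R
  ne_zero : e ≠ 0
  primitive : ∀ e₁ e₂ : R, IsIdempotentElem e₁ → IsIdempotentElem e₂ →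
    e₁ ∈ Set.center R → e₂ ∈ Set.center R → e₁ * e₂ = 0 → e₁ + e₂ = e → e₁ = 0 ∨ e₂ = 0

/-- The set `A e`, as a (not necessarily unital) subalgebra of `A`.
For a central idempotent `e` it is the two-sided ideal generated by `e`, with identity `e`. -/
def component (F : Type*) {A : Type*} [CommRing F] [Ring A] [Algebra F A] (e : A) :
    NonUnitalSubalgebra F A where
  carrier := {x | ∃ a : A, x = a * e}
  add_mem' := by
    rintro _ _ ⟨a, rfl⟩ ⟨b, rfl⟩
    exact ⟨a + b, (add_mul a b e).symm⟩
  zero_mem' := ⟨0, (zero_mul e).symm⟩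
  mul_mem' := by
    rintro _ _ ⟨a, rfl⟩ ⟨b, rfl⟩
    exact ⟨a * e * b, by simp only [mul_assoc]⟩
  smul_mem' := by
    rintro c _ ⟨a, rfl⟩
    exact ⟨c • a, (smul_mul_assoc c a e).symm⟩

variable {G : Type*} [Group G]

/-- The conjugate `α ^ g = g⁻¹ α g` of an element of the group algebra. -/
noncomputable def conjBy {F : Type*} [Field F] (α : MonoidAlgebra F G) (g : G) :
    MonoidAlgebra F G :=
  MonoidAlgebra.single g⁻¹ 1 * α * MonoidAlgebra.single g 1

/-- `M̂ = |M|⁻¹ ∑_{m ∈ M} m`. -/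
noncomputable def hat (F : Type*) [Field F] (M : Subgroup G) : MonoidAlgebra F G :=
  (Nat.card M : F)⁻¹ • ∑ᶠ m : M, MonoidAlgebra.single (m : G) 1

/-- `M / K` is a minimal nontrivial normal subgroup of `H / K`. -/
def IsMinimalNormalOver (H K M : Subgroup G) : Prop :=
  Minimal (fun M' : Subgroup G =>
    K < M' ∧ M' ≤ H ∧ H ≤ Subgroup.normalizer (M' : Set G)) M

variable [Finite G]

theorem commute_single_hat {F : Type*} [Field F] {M : Subgroup G} {x : G}
    (hx : x ∈ Subgroup.normalizer (M : Set G)) :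
    Commute (MonoidAlgebra.single x (1 : F)) (hat F M) := by
  classical
  have := Fintype.ofFinite M
  unfold hat
  refine Commute.smul_right ?_ _
  rw [finsum_eq_sum_of_fintype]
  change _ * _ = _ * _
  rw [Finset.mul_sum, Finset.sum_mul]
  refine Fintype.sum_equiv (Subgroup.normalizerMonoidHom M ⟨x, hx⟩).toEquiv _ _ ?_
  intro m
  have h : ((Subgroup.normalizerMonoidHom M ⟨x, hx⟩ m : M) : G) = x * m * x⁻¹ := rfl
  simp only [MonoidAlgebra.single_mul_single, mul_one]
  exact congrArg (fun y => MonoidAlgebra.single y (1 : F)) (by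
    change x * m = ((Subgroup.normalizerMonoidHom M ⟨x, hx⟩ m : M) : G) * x
    rw [h, inv_mul_cancel_right])

theorem commute_hat {F : Type*} [Field F] {M M' : Subgroup G}
    (h : M ≤ Subgroup.normalizer (M' : Set G)) : Commute (hat F M) (hat F M') := by
  classical
  have := Fintype.ofFinite M
  rw [hat.eq_def F M, finsum_eq_sum_of_fintype]
  exact (Commute.sum_left _ _ _ fun m _ => commute_single_hat (h m.2)).smul_left _

/-- `ε(H, K) = K̂ ∏_{M / K} (1 - M̂)`, where `M / K` runs over the minimal nontrivial normal
subgroups of `H / K` (so that `ε(H, H) = Ĥ`). The factors commute. -/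
noncomputable def eps (F : Type*) [Field F] (H K : Subgroup G) : MonoidAlgebra F G :=
  hat F K * (Set.toFinite {M : Subgroup G | IsMinimalNormalOver H K M}).toFinset.noncommProd
    (fun M => 1 - hat F M) (by
      intro M hM M' hM' _
      have h1 : IsMinimalNormalOver H K M := by simpa using hM
      have h2 : IsMinimalNormalOver H K M' := by simpa using hM'
      exact (((Commute.one_left _).sub_left
        ((Commute.one_right _).sub_right (commute_hat (h1.prop.2.1.trans h2.prop.2.2))))))

/-- Strong Shoda pairs `(H, K)` of `G`. -/
structure IsStrongShodaPair (H K : Subgroup G) : Prop where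
  le : K ≤ H
  le_normalizer : H ≤ Subgroup.normalizer (K : Set G)
  normal : (H.subgroupOf (Subgroup.normalizer (K : Set G))).Normal
  /-- `H / K` is cyclic. -/
  cyclic : IsCyclic ((H.subgroupOf (Subgroup.normalizer (K : Set G))).map
    (QuotientGroup.mk' (K.subgroupOf (Subgroup.normalizer (K : Set G)))))
  /-- `H / K` is a maximal abelian subgroup of `N_G(K) / K`. -/
  maximal_abelian : Maximal (fun A : Subgroup
      (Subgroup.normalizer (K : Set G) ⧸ K.subgroupOf (Subgroup.normalizer (K : Set G))) =>
        IsMulCommutative A)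
    ((H.subgroupOf (Subgroup.normalizer (K : Set G))).map
      (QuotientGroup.mk' (K.subgroupOf (Subgroup.normalizer (K : Set G)))))
  orthogonal : ∀ g : G, g ∉ Subgroup.normalizer (K : Set G) →
    eps ℚ H K * conjBy (eps ℚ H K) g = 0

open scoped Classical in
/-- The character of `G` induced from a linear character `ψ` of `H`:
`ψ^G(g) = |H|⁻¹ ∑_{x ∈ G} ψ°(x g x⁻¹)`. -/
noncomputable def inducedCharacter (H : Subgroup G) (ψ : H →* ℂˣ) (g : G) : ℂ :=
  (Nat.card H : ℂ)⁻¹ *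
    ∑ᶠ x : G, if h : x * g * x⁻¹ ∈ H then (ψ ⟨x * g * x⁻¹, h⟩ : ℂ) else 0

/-- Every irreducible complex character of `G` is induced from a linear character, with kernel `K`,
of a subgroup `H` such that `(H, K)` is a strong Shoda pair. -/
def IsStronglyMonomial (G : Type*) [Group G] [Finite G] : Prop :=
  ∀ (n : ℕ) (ρ : Representation ℂ G (Fin n → ℂ)), ρ.IsIrreducible →
    ∃ (H K : Subgroup G) (ψ : H →* ℂˣ), IsStrongShodaPair H K ∧
      ψ.ker = K.subgroupOf H ∧ ∀ g : G, ρ.character g = inducedCharacter H ψ g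

end Idempotents

/-! ### Galois orbits of faithful characters, and the idempotents they define -/

section Orbits

variable (F : Type*) [Field F] {G : Type*} [Group G]

/-- The field `F(ζ_k)`, `k = [H : K]`. -/
abbrev CycField (H K : Subgroup G) : Type _ := CyclotomicField (K.relIndex H) F

/-- The faithful characters of `H / K`, viewed as the linear characters of `H` with kernel `K`.
Their values are `[H : K]`-th roots of unity. -/
@[ext]
structure FaithfulChar (H K : Subgroup G) where
  toHom : H →* (CycField F H K)ˣ
  ker_eq : toHom.ker = K.subgroupOf H

variable {F} {H K : Subgroup G}

/-- `Gal(F(ζ_k) / F)` acts on characters through their values. -/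
noncomputable instance FaithfulChar.instMulAction :
    MulAction (CycField F H K ≃ₐ[F] CycField F H K) (FaithfulChar F H K) where
  smul s χ :=
    { toHom := (Units.map (s : CycField F H K →* CycField F H K)).comp χ.toHom
      ker_eq := by
        rw [← χ.ker_eq]
        ext h
        rw [MonoidHom.mem_ker, MonoidHom.mem_ker, MonoidHom.comp_apply]
        exact map_eq_one_iff _ (Units.map_injective s.injective) }
  one_smul _ := rfl
  mul_smul _ _ _ := rfl

theorem FaithfulChar.smul_apply (s : CycField F H K ≃ₐ[F] CycField F H K)
    (χ : FaithfulChar F H K) (h : H) :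
    ((s • χ).toHom h : CycField F H K) = s (χ.toHom h : CycField F H K) := rfl

variable (F H K) in
/-- `𝒞_F(H/K)`: the orbits of the faithful characters of `H / K` under `Gal(F(ζ_k) / F)`. -/
abbrev CharOrbit : Type _ :=
  MulAction.orbitRel.Quotient (CycField F H K ≃ₐ[F] CycField F H K) (FaithfulChar F H K)

/-- The orbit of a faithful character. -/
noncomputable def FaithfulChar.orbit (χ : FaithfulChar F H K) : CharOrbit F H K := Quotient.mk'' χ

/-- `|H|⁻¹ ∑_{h ∈ H} tr(χ(hK)) h⁻¹`, where `tr` is the trace of `F(ζ_k) / F`. -/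
noncomputable def epsChar (χ : FaithfulChar F H K) : MonoidAlgebra F G :=
  (Nat.card H : F)⁻¹ • ∑ᶠ h : H, MonoidAlgebra.single (h : G)⁻¹
    (Algebra.trace F (CycField F H K) (χ.toHom h : CycField F H K))

/-- `ε_C(H, K)`, for `C` in `𝒞_F(H/K)`. -/
noncomputable def epsOrbit (C : CharOrbit F H K) : MonoidAlgebra F G :=
  Quotient.liftOn' C epsChar (by
    rintro χ ψ ⟨s, hs⟩
    subst hs
    unfold epsChar
    congr 2
    funext h
    rw [show ((fun m => m • ψ) s) = s • ψ from rfl, FaithfulChar.smul_apply,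
      Algebra.trace_eq_of_algEquiv s])

/-- `e_C(G, H, K)`: the sum of the different `G`-conjugates of `ε_C(H, K)`. -/
noncomputable def eOrbit [Finite G] (C : CharOrbit F H K) : MonoidAlgebra F G :=
  ∑ x ∈ (Set.finite_range fun g : G => conjBy (epsOrbit C) g).toFinset, x

/-- `N_G(H) ∩ N_G(K)`. -/
abbrev biNormalizer (H K : Subgroup G) : Subgroup G :=
  Subgroup.normalizer (H : Set G) ⊓ Subgroup.normalizer (K : Set G)

/-- The conjugate character `χ ^ g`, `χ ^ g (g⁻¹ h g) = χ(h)`, for `g ∈ N_G(H) ∩ N_G(K)`. -/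
noncomputable def FaithfulChar.conj (χ : FaithfulChar F H K) (g : biNormalizer H K) : FaithfulChar F H K where
  toHom := χ.toHom.comp (Subgroup.normalizerMonoidHom H ⟨g, g.2.1⟩).toMonoidHom
  ker_eq := by
    ext h
    have h1 : ∀ x : H, χ.toHom x = 1 ↔ (x : G) ∈ K := fun x => by
      rw [← MonoidHom.mem_ker, χ.ker_eq, Subgroup.mem_subgroupOf]
    rw [MonoidHom.mem_ker, Subgroup.mem_subgroupOf]
    exact (h1 _).trans (Subgroup.mem_normalizer_iff.mp g.2.2 h).symm

theorem FaithfulChar.conj_apply (χ : FaithfulChar F H K) (g : biNormalizer H K) (h : H) :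
    (χ.conj g).toHom h = χ.toHom ⟨g * h * (g : G)⁻¹,
      (Subgroup.mem_normalizer_iff.mp g.2.1 h).mp h.2⟩ := rfl

/-- The action `C ↦ C ^ g` of `N_G(H) ∩ N_G(K)` on `𝒞_F(H/K)`. -/
noncomputable def orbitConj (C : CharOrbit F H K) (g : biNormalizer H K) : CharOrbit F H K :=
  Quotient.map' (fun χ => χ.conj g) (by
    rintro χ ψ ⟨s, hs⟩
    subst hs
    exact ⟨s, rfl⟩) C

theorem orbitConj_one (C : CharOrbit F H K) : orbitConj C 1 = C := by
  induction C using Quotient.inductionOn' with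
  | h χ =>
    refine congrArg Quotient.mk'' ?_
    ext h
    simp [FaithfulChar.conj_apply]

theorem orbitConj_mul (C : CharOrbit F H K) (g g' : biNormalizer H K) :
    orbitConj C (g * g') = orbitConj (orbitConj C g) g' := by
  induction C using Quotient.inductionOn' with
  | h χ =>
    refine congrArg Quotient.mk'' ?_
    ext h
    simp [FaithfulChar.conj_apply, mul_assoc]

variable (F H K) in
/-- `E_F(G, H/K)`: the stabilizer in `N_G(H) ∩ N_G(K)` of any element of `𝒞_F(H/K)`
(for cyclic `H / K` all elements of `𝒞_F(H/K)` have the same stabilizer). -/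
noncomputable def stabE : Subgroup G where
  carrier := {g | ∃ hg : g ∈ biNormalizer H K, ∀ C : CharOrbit F H K, orbitConj C ⟨g, hg⟩ = C}
  one_mem' := ⟨one_mem _, orbitConj_one⟩
  mul_mem' := by
    rintro a b ⟨ha, ha'⟩ ⟨hb, hb'⟩
    refine ⟨mul_mem ha hb, fun C => ?_⟩
    rw [show (⟨a * b, mul_mem ha hb⟩ : biNormalizer H K) = ⟨a, ha⟩ * ⟨b, hb⟩ from rfl,
      orbitConj_mul, ha', hb']
  inv_mem' := by
    rintro a ⟨ha, ha'⟩
    refine ⟨inv_mem ha, fun C => ?_⟩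
    have h := ha' (orbitConj C ⟨a⁻¹, inv_mem ha⟩)
    rw [← orbitConj_mul, show (⟨a⁻¹, inv_mem ha⟩ * ⟨a, ha⟩ : biNormalizer H K) = 1 from
      Subtype.ext (inv_mul_cancel a), orbitConj_one] at h
    exact h.symm

instance normal_subgroupOf_stabE : (H.subgroupOf (stabE F H K)).Normal :=
  ⟨fun h hh g => by
    obtain ⟨hg, _⟩ := g.2
    exact (Subgroup.mem_normalizer_iff.mp hg.1 h).mp hh⟩

/-- `E_F(G, H/K)` contains `H` as soon as `K` is normal in `H`. -/
theorem le_stabE (hHK : H ≤ Subgroup.normalizer (K : Set G)) : H ≤ stabE F H K := by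
  intro x hx
  refine ⟨⟨Subgroup.le_normalizer hx, hHK hx⟩, fun C => ?_⟩
  induction C using Quotient.inductionOn' with
  | h χ =>
    refine congrArg Quotient.mk'' (FaithfulChar.ext (MonoidHom.ext fun h => ?_))
    rw [FaithfulChar.conj_apply]
    change χ.toHom (⟨x, hx⟩ * h * ⟨x, hx⟩⁻¹) = _
    rw [map_mul, map_mul, mul_right_comm, ← map_mul, mul_inv_cancel, map_one, one_mul]

variable (F H K) in
/-- The group `E / H`, where `E = E_F(G, H/K)`. -/
abbrev EmodH : Type _ := stabE F H K ⧸ H.subgroupOf (stabE F H K)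

end Orbits

/-! ### Crossed products -/

section Crossed

/-- An action `σ` and a twisting `τ` of a group `Γ` on a commutative `F`-algebra `L`, in the
convention in which the crossed product has multiplication `a u_g = u_g σ_g(a)` and
`u_g u_h = u_{gh} τ(g, h)`. -/
structure CrossedSystem (F L Γ : Type*) [CommRing F] [CommRing L] [Algebra F L] [Group Γ] where
  σ : Γ → (L ≃ₐ[F] L)
  τ : Γ → Γ → Lˣ
  σ_mul : ∀ g h a, σ h (σ g a) = σ (g * h) a
  cocycle : ∀ g h k, (τ (g * h) k : L) * σ k (τ g h : L) = τ g (h * k) * τ h k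

variable {F L Γ : Type*} [CommRing F] [CommRing L] [Algebra F L] [Group Γ]

namespace CrossedSystem

variable (S : CrossedSystem F L Γ)

theorem σ_one (a : L) : S.σ 1 a = a :=
  (S.σ 1).injective (by rw [S.σ_mul, one_mul])

theorem τ_one_left (g : Γ) : (S.τ 1 g : L) = S.σ g (S.τ 1 1 : L) := by
  have h := S.cocycle 1 1 g
  rw [one_mul, one_mul] at h
  exact ((S.τ 1 g).isUnit.mul_left_cancel h).symm

theorem τ_one_right (g : Γ) : S.τ g 1 = S.τ 1 1 := by
  have h := S.cocycle g 1 1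
  rw [mul_one, mul_one, S.σ_one] at h
  exact Units.ext ((S.τ g 1).isUnit.mul_left_cancel h)

/-- The multiplication of the crossed product, where the finitely supported function `f` stands
for `∑_g u_g f(g)`: the bilinear map with `(u_g a) (u_h b) = u_{gh} τ(g, h) σ_h(a) b`. -/
noncomputable def mulHom : (Γ →₀ L) →ₗ[F] (Γ →₀ L) →ₗ[F] (Γ →₀ L) :=
  Finsupp.lsum F fun g => LinearMap.flip (Finsupp.lsum F fun h => LinearMap.flip
    ((LinearMap.mul F L).compr₂ ((Finsupp.lsingle (g * h) : L →ₗ[F] Γ →₀ L).comp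
      (LinearMap.mulLeft F (S.τ g h : L))) ∘ₗ (S.σ h).toLinearMap))

theorem mulHom_single (g h : Γ) (a b : L) :
    S.mulHom (Finsupp.single g a) (Finsupp.single h b) =
      Finsupp.single (g * h) (S.τ g h * (S.σ h a * b)) := by
  simp [mulHom]

theorem mulHom_assoc (a b c : Γ →₀ L) :
    S.mulHom (S.mulHom a b) c = S.mulHom a (S.mulHom b c) := by
  induction a using Finsupp.induction_linear with
  | zero => simp
  | add f g hf hg => simp only [map_add, LinearMap.add_apply, hf, hg]
  | single x a =>
  induction b using Finsupp.induction_linear with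
  | zero => simp
  | add f g hf hg => simp only [map_add, LinearMap.add_apply, hf, hg]
  | single y b =>
  induction c using Finsupp.induction_linear with
  | zero => simp
  | add f g hf hg => simp only [map_add, hf, hg]
  | single z c =>
  simp only [mulHom_single, map_mul, S.σ_mul, mul_assoc x y z]
  congr 1
  linear_combination (S.σ (y * z) a * S.σ z b * c) * S.cocycle x y z

theorem mulHom_one_left (a : Γ →₀ L) :
    S.mulHom (Finsupp.single 1 ((S.τ 1 1)⁻¹ : Lˣ)) a = a := by
  induction a using Finsupp.induction_linear with
  | zero => simp
  | add f g hf hg => simp only [map_add, hf, hg]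
  | single x a =>
  rw [mulHom_single, one_mul, τ_one_left, ← mul_assoc, ← map_mul, Units.mul_inv, map_one, one_mul]

theorem mulHom_one_right (a : Γ →₀ L) :
    S.mulHom a (Finsupp.single 1 ((S.τ 1 1)⁻¹ : Lˣ)) = a := by
  induction a using Finsupp.induction_linear with
  | zero => simp
  | add f g hf hg => simp only [map_add, LinearMap.add_apply, hf, hg]
  | single x a =>
  rw [mulHom_single, mul_one, τ_one_right, σ_one, mul_left_comm, Units.mul_inv, mul_one]

/-- The crossed product `L *_τ^σ Γ`: the free right `L`-module with basis `u_g` (`g ∈ Γ`), with the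
multiplication above and the identity `u_1 τ(1, 1)⁻¹`. -/
def Product (_ : CrossedSystem F L Γ) : Type _ := Γ →₀ L

noncomputable instance : AddCommGroup S.Product := inferInstanceAs (AddCommGroup (Γ →₀ L))

noncomputable instance : Module F S.Product := inferInstanceAs (Module F (Γ →₀ L))

noncomputable instance : Ring S.Product where
  __ := (inferInstance : AddCommGroup S.Product)
  mul a b := S.mulHom a b
  one := (Finsupp.single 1 (((S.τ 1 1)⁻¹ : Lˣ) : L) : Γ →₀ L)
  left_distrib a b c := map_add (S.mulHom a) b c
  right_distrib a b c := by
    exact (congrFun (congrArg DFunLike.coe (map_add S.mulHom a b)) c)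
  zero_mul a := by
    exact (congrFun (congrArg DFunLike.coe (map_zero S.mulHom)) a)
  mul_zero a := map_zero (S.mulHom a)
  mul_assoc := S.mulHom_assoc
  one_mul := S.mulHom_one_left
  mul_one := S.mulHom_one_right

noncomputable instance : Algebra F S.Product :=
  Algebra.ofModule
    (fun r a b => congrFun (congrArg DFunLike.coe (map_smul S.mulHom r a)) b)
    (fun r a b => map_smul (S.mulHom a) r b)

end CrossedSystem

end Crossed

/-! ### The crossed product `F(ζ_k) *_τ^σ E/H` -/

section Main

variable {F : Type*} [Field F] {G : Type*} [Group G] {H K : Subgroup G}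

/-- `σ` and `τ` are the action and the twisting on `F(ζ)` of `E / H` that are determined by a
generator `yK` of `H / K` and a section `φ` of the projection onto `E / H`:
`σ_x(ζ) = ζ ^ i` if `φ(x)⁻¹ y φ(x) K = y ^ i K`, and
`τ(x, x') = ζ ^ j` if `φ(x x')⁻¹ φ(x) φ(x') K = y ^ j K`.
The values of `φ` are given by representatives in `E`; only their classes in `E / K` matter. -/
structure IsShodaSystem (ζ : CycField F H K) (y : H) (φ : EmodH F H K → stabE F H K)
    (S : CrossedSystem F (CycField F H K) (EmodH F H K)) : Prop where
  action : ∀ (x : EmodH F H K) (i : ℤ),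
    ((((φ x : G)⁻¹ * (y : G) * (φ x : G) : G) : G ⧸ K) = ((y : G) ^ i : G)) →
      S.σ x ζ = ζ ^ i
  twisting : ∀ (x x' : EmodH F H K) (j : ℤ),
    ((((φ (x * x') : G)⁻¹ * (φ x : G) * (φ x' : G) : G) : G ⧸ K) = ((y : G) ^ j : G)) →
      (S.τ x x' : CycField F H K) = ζ ^ j

end Main

end ShodaPairs

/-!
Everything rests on one embedding. Let `χ` be a linear character of a subgroup `H` with kernel `K`
whose values generate the Galois extension `L` of `F`. The map
`s(a) = |H|⁻¹ ∑_h tr(a χ(h)) h⁻¹` (`traceChar`) is linear and multiplicative from `L` to `FG`, by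
orthogonality of the Galois conjugates of `χ` (`traceChar_mul_traceChar`); it satisfies
`x s(a) = s(χ(x) a)` for `x ∈ H`, and `s(1) = ε_C(H, K)`.

*Components of strong Shoda pairs.* Conjugation by an element of `N(K)` turns `s` into the map of a
conjugate character. If this is a Galois conjugate of `χ`, that is for elements of `E`, the
idempotent `ε = s(1)` is preserved; otherwise `ε` is orthogonal to its conjugate. It is so for
elements outside `N(K)` too, since `ε` is a multiple of `ε(H, K)`. So the different conjugates of
`ε` are indexed by `G / E` and mutually orthogonal (`IsStrongShodaPair.hasOrthogonalConjugates`).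
Their sum `e_C` is therefore a central idempotent whose component is the ring of `[G : E]`-rowed
matrices over `ε FG ε` (`exists_bijective_component_matrix`), and `ε FG ε` is the sum of the spaces
`φ(x) s(L)` for `x ∈ E / H`, in which multiplication is that of the crossed product
(`crossedEmbedding_mulHom`). Because `H / K` is maximal abelian in `N(K) / K`, the group `E / H`
acts faithfully on `L`; so a central element `z` has `z ε ∈ s(L)` (`exists_mul_traceChar_one_eq`),
and as `L` is a field, `e_C` is primitive.

*All components arise.* A primitive central idempotent `e` of `FG` acts as the identity on some
irreducible complex representation `ρ`. If `ρ` affords `ψ^G`, the trace of `ρ(ε_ψ)`, for the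
idempotent `ε_ψ` of `ψ` over `ℂ`, is up to a positive factor a sum of natural numbers that are not
all zero (`asAlgebraHom_traceChar_ne_zero`). As `ε_ψ` is a multiple of the image of `ε_C(H, K)` for
the character `χ` that corresponds to `ψ`, the product `e e_C` does not vanish, and `e = e_C`.

*Abelian-by-supersolvable groups.* Let `ρ` be irreducible, and let `N₀ ≤ N₁ ≤ ⋯ ≤ G` be a chain of
normal subgroups with `N₀` abelian and cyclic factors. If `A ≥ N₀` stabilizes a line and acts on it
with kernel `L`, then `(A, L)` is a strong Shoda pair as soon as `A` is large enough: an element of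
`N(L)` that centralizes `A / L` but is not in `A` can be chosen, by means of the chain, such that
`N(L)` normalizes the group it generates together with `A` (`exists_normalized_extension`); an
eigenvector of this element in the `A`-eigenspace of the line gives a line stabilized by the larger
group (`exists_lineStabilizer_extension`), and the orthogonality of conjugates is inherited
(`IsAdmissible.extend`). For a maximal such `A` no element of this kind is left, and the character
of `A` on the line induces the character of `ρ` (`IsStrongShodaPair.character_eq_inducedCharacter`).
-/

namespace ShodaPairs

open MonoidAlgebra
open scoped commutatorElement

/-! ### The idempotents of subgroups -/

section Hat

variable {F : Type*} [Field F] {G : Type*} [Group G] [Finite G]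

omit [Finite G] in
theorem hat_eq_sum (M : Subgroup G) [Fintype M] :
    hat F M = (Nat.card M : F)⁻¹ • ∑ m : M, single (m : G) 1 := by
  rw [hat, finsum_eq_sum_of_fintype]

theorem single_mul_hat {M : Subgroup G} {m : G} (hm : m ∈ M) :
    single m (1 : F) * hat F M = hat F M := by
  have := Fintype.ofFinite M
  rw [hat_eq_sum, mul_smul_comm, Finset.mul_sum]
  congr 1
  refine Fintype.sum_equiv (Equiv.mulLeft (⟨m, hm⟩ : M)) _ _ fun x => ?_
  simp [single_mul_single]

theorem hat_mul_single {M : Subgroup G} {m : G} (hm : m ∈ M) :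
    hat F M * single m (1 : F) = hat F M := by
  rw [← (commute_single_hat (Subgroup.le_normalizer hm)).eq, single_mul_hat hm]

variable [CharZero F]

theorem hat_mul_of_forall {M : Subgroup G} {z : MonoidAlgebra F G}
    (h : ∀ m ∈ M, single m (1 : F) * z = z) : hat F M * z = z := by
  have := Fintype.ofFinite M
  have hc : (Nat.card M : F) ≠ 0 := Nat.cast_ne_zero.mpr Nat.card_pos.ne'
  rw [hat_eq_sum, smul_mul_assoc, Finset.sum_mul, Finset.sum_congr rfl fun (m : M) _ => h m m.2,
    Finset.sum_const, Finset.card_univ, ← Nat.card_eq_fintype_card, ← Nat.cast_smul_eq_nsmul F,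
    inv_smul_smul₀ hc]

theorem mul_hat_of_forall {M : Subgroup G} {z : MonoidAlgebra F G}
    (h : ∀ m ∈ M, z * single m (1 : F) = z) : z * hat F M = z := by
  have := Fintype.ofFinite M
  have hc : (Nat.card M : F) ≠ 0 := Nat.cast_ne_zero.mpr Nat.card_pos.ne'
  rw [hat_eq_sum, mul_smul_comm, Finset.mul_sum, Finset.sum_congr rfl fun (m : M) _ => h m m.2,
    Finset.sum_const, Finset.card_univ, ← Nat.card_eq_fintype_card, ← Nat.cast_smul_eq_nsmul F,
    inv_smul_smul₀ hc]

theorem hat_mul_hat_of_le {M N : Subgroup G} (h : N ≤ M) : hat F N * hat F M = hat F M :=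
  hat_mul_of_forall fun _ hm => single_mul_hat (h hm)

theorem hat_mul_hat_of_ge {M N : Subgroup G} (h : N ≤ M) : hat F M * hat F N = hat F M :=
  mul_hat_of_forall fun _ hm => hat_mul_single (h hm)

theorem hat_mul_hat_eq_hat_sup {K M : Subgroup G} (h : M ≤ Subgroup.normalizer (K : Set G)) :
    hat F K * hat F M = hat F (K ⊔ M) := by
  have hz : ∀ g ∈ K ⊔ M, single g (1 : F) * (hat F K * hat F M) = hat F K * hat F M := by
    intro g hg
    rw [← SetLike.mem_coe, Subgroup.coe_mul_of_right_le_normalizer_left K M h] at hg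
    obtain ⟨x, hx, y, hy, rfl⟩ := hg
    rw [show single (x * y) (1 : F) = single x 1 * single y 1 by simp [single_mul_single],
      mul_assoc, ← mul_assoc (single y 1), (commute_single_hat (h hy)).eq, mul_assoc,
      single_mul_hat hy, ← mul_assoc, single_mul_hat hx]
  rw [← hat_mul_of_forall hz, ← mul_assoc, hat_mul_hat_of_ge le_sup_left,
    hat_mul_hat_of_ge le_sup_right]

omit [CharZero F] in
theorem single_mul_hat_map_conj (g : G) (M : Subgroup G) :
    single g (1 : F) * hat F M = hat F (M.map (MulAut.conj g).toMonoidHom) * single g 1 := by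
  have := Fintype.ofFinite M
  have := Fintype.ofFinite (M.map (MulAut.conj g).toMonoidHom)
  let e := M.equivMapOfInjective (MulAut.conj g).toMonoidHom (MulAut.conj g).injective
  rw [hat_eq_sum, hat_eq_sum, mul_smul_comm, Finset.mul_sum, smul_mul_assoc, Finset.sum_mul,
    Nat.card_congr e.toEquiv]
  congr 1
  refine Fintype.sum_equiv e.toEquiv _ _ fun x => ?_
  have : (e x : G) = g * x * g⁻¹ := rfl
  simp only [single_mul_single, mul_one]
  exact congrArg (fun y => single y (1 : F)) (by
    change g * x = (e x : G) * g
    rw [this, inv_mul_cancel_right])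

end Hat

/-! ### The idempotents `ε(H, K)` -/

section Eps

variable {F : Type*} [Field F] {G : Type*} [Group G] [Finite G] {H K : Subgroup G}

omit [Finite G] in
theorem le_normalizer_of_commutator_le {P : Subgroup G} (hHK : ⁅H, H⁆ ≤ K) (hKP : K ≤ P)
    (hPH : P ≤ H) : H ≤ Subgroup.normalizer (P : Set G) := by
  refine Subgroup.le_normalizer_iff.mpr fun h hh p hp => ?_
  have := P.mul_mem (hKP (hHK (Subgroup.commutator_mem_commutator hh (hPH hp)))) hp
  simpa [commutatorElement_def] using this

theorem eps_eq_noncommProd (F : Type*) [Field F] (H K : Subgroup G) :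
    ∃ comm, eps F H K = hat F K * (Set.toFinite {M : Subgroup G |
      IsMinimalNormalOver H K M}).toFinset.noncommProd (fun M => 1 - hat F M) comm :=
  ⟨_, rfl⟩

/-- A submonoid that contains the factors of `ε(H, K)` contains `ε(H, K)`. This is how the
properties of the noncommutative product are obtained without enumerating its factors. -/
theorem eps_mem_submonoid (S : Submonoid (MonoidAlgebra F G)) (hK : hat F K ∈ S)
    (hM : ∀ M, IsMinimalNormalOver H K M → 1 - hat F M ∈ S) : eps F H K ∈ S :=
  S.mul_mem hK (Submonoid.noncommProd_mem _ _ _ _ fun M h => hM M (by simpa using h))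

theorem commute_eps {z : MonoidAlgebra F G} (hK : Commute z (hat F K))
    (hM : ∀ M, IsMinimalNormalOver H K M → Commute z (hat F M)) : Commute z (eps F H K) :=
  (eps_mem_submonoid (Submonoid.centralizer {z}) (by rintro _ rfl; exact hK)
    fun M h => by rintro _ rfl; exact (Commute.one_right _).sub_right (hM M h)) z rfl

theorem commute_single_eps (hHK : H ≤ Subgroup.normalizer (K : Set G)) {h : G} (hh : h ∈ H) :
    Commute (single h (1 : F)) (eps F H K) :=
  commute_eps (commute_single_hat (hHK hh)) fun _ hM => commute_single_hat (hM.prop.2.2 hh)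

theorem commute_hat_eps (hHK : H ≤ Subgroup.normalizer (K : Set G)) {M : Subgroup G} (hM : M ≤ H) :
    Commute (hat F M) (eps F H K) :=
  commute_eps (commute_hat (hM.trans hHK)) fun _ hM' => commute_hat (hM.trans hM'.prop.2.2)

theorem mul_eps_eq_self {z : MonoidAlgebra F G} (hK : z * hat F K = z)
    (hM : ∀ M, IsMinimalNormalOver H K M → z * hat F M = 0) : z * eps F H K = z := by
  let S : Submonoid (MonoidAlgebra F G) :=
    { carrier := {x | z * x = z}
      one_mem' := mul_one z
      mul_mem' := fun {a b} ha hb => by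
        change z * (a * b) = z
        rw [← mul_assoc, show z * a = z from ha, show z * b = z from hb] }
  exact eps_mem_submonoid S hK fun M h => by
    change z * (1 - hat F M) = z
    rw [mul_sub, mul_one, hM M h, sub_zero]

omit [Finite G] in
theorem mapRingHom_smul {F' : Type*} [Field F'] (f : F →+* F') (c : F) (x : MonoidAlgebra F G) :
    mapRingHom G f (c • x) = f c • mapRingHom G f x := by
  ext g
  simp [coeff_mapRingHom]

theorem map_hat {F' : Type*} [Field F'] (f : F →+* F') (M : Subgroup G) :
    mapRingHom G f (hat F M) = hat F' M := by
  have := Fintype.ofFinite M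
  rw [hat_eq_sum, hat_eq_sum, mapRingHom_smul, map_sum]
  simp [mapRingHom_single]

theorem map_eps {F' : Type*} [Field F'] (f : F →+* F') :
    mapRingHom G f (eps F H K) = eps F' H K := by
  obtain ⟨c, hc⟩ := eps_eq_noncommProd F H K
  obtain ⟨c', hc'⟩ := eps_eq_noncommProd F' H K
  rw [hc, hc', map_mul, map_hat, Finset.map_noncommProd]
  congr 1
  refine Finset.noncommProd_congr rfl (fun M _ => ?_) _
  simp [map_hat]

variable [CharZero F]

theorem eps_mul_hat_self (hHK : H ≤ Subgroup.normalizer (K : Set G)) (hKH : K ≤ H) :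
    eps F H K * hat F K = eps F H K := by
  rw [← (commute_hat_eps hHK hKH).eq, eps, ← mul_assoc, hat_mul_hat_of_le le_rfl]

/-- If `H / K` is abelian, `ε(H, K)` annihilates the idempotent of every subgroup of `H` that is not
contained in `K`: modulo `K` such a subgroup contains a minimal subgroup of `H / K`. -/
theorem eps_mul_hat_eq_zero (hKH : K ≤ H) (hHK : ⁅H, H⁆ ≤ K) {M : Subgroup G} (hMH : M ≤ H)
    (hMK : ¬ M ≤ K) : eps F H K * hat F M = 0 := by
  classical
  have hn : H ≤ Subgroup.normalizer (K : Set G) := le_normalizer_of_commutator_le hHK le_rfl hKH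
  obtain ⟨P, hP, hmin⟩ := exists_minimal_le_of_wellFoundedLT
    (fun M' : Subgroup G => K < M' ∧ M' ≤ H ∧ H ≤ Subgroup.normalizer (M' : Set G)) (K ⊔ M)
    ⟨left_lt_sup.mpr hMK, sup_le hKH hMH,
      le_normalizer_of_commutator_le hHK le_sup_left (sup_le hKH hMH)⟩
  obtain ⟨c, hc⟩ := eps_eq_noncommProd F H K
  have hmem : P ∈ (Set.toFinite {M : Subgroup G | IsMinimalNormalOver H K M}).toFinset := by
    simpa [IsMinimalNormalOver] using hmin
  rw [← eps_mul_hat_self hn hKH, mul_assoc, hat_mul_hat_eq_hat_sup (hMH.trans hn),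
    ← hat_mul_hat_of_le (F := F) hP, ← mul_assoc, hc, ← Finset.noncommProd_erase_mul _ hmem]
  simp [mul_assoc, sub_mul, hat_mul_hat_of_le (F := F) (le_refl P)]

end Eps

/-! ### Strong Shoda pairs -/

section StrongShodaPair

variable {G : Type*} [Group G] [Finite G] {H K : Subgroup G}

theorem IsStrongShodaPair.normalizer_le (h : IsStrongShodaPair H K) :
    Subgroup.normalizer (K : Set G) ≤ Subgroup.normalizer (H : Set G) := by
  have := Subgroup.normal_subgroupOf_iff_le_normalizer h.le_normalizer |>.mp h.normal
  exact this

omit [Finite G] in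
theorem mem_map_mk'_subgroupOf {T : Subgroup G} (hKH : K ≤ H) [(K.subgroupOf T).Normal] (g : T) :
    QuotientGroup.mk' (K.subgroupOf T) g ∈
      (H.subgroupOf T).map (QuotientGroup.mk' (K.subgroupOf T)) ↔ (g : G) ∈ H := by
  constructor
  · rintro ⟨h, hh, heq⟩
    have h1 : h⁻¹ * g ∈ K.subgroupOf T := QuotientGroup.eq.mp heq
    have h2 := H.mul_mem hh (hKH (Subgroup.mem_subgroupOf.mp h1))
    simpa using h2
  · exact fun hg => Subgroup.mem_map_of_mem _ (Subgroup.mem_subgroupOf.mpr hg)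

omit [Finite G] in
theorem mk'_subgroupOf_commute_iff {T : Subgroup G} [(K.subgroupOf T).Normal] (a b : T) :
    Commute (QuotientGroup.mk' (K.subgroupOf T) a) (QuotientGroup.mk' (K.subgroupOf T) b) ↔
      ⁅(a : G), (b : G)⁆ ∈ K := by
  rw [← commutatorElement_eq_one_iff_commute, ← map_commutatorElement, QuotientGroup.mk'_apply,
    QuotientGroup.eq_one_iff, Subgroup.mem_subgroupOf]
  rfl

theorem IsStrongShodaPair.commutator_le (h : IsStrongShodaPair H K) : ⁅H, H⁆ ≤ K := by
  rw [Subgroup.commutator_le]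
  intro a ha b hb
  have ha' := (mem_map_mk'_subgroupOf h.le ⟨a, h.le_normalizer ha⟩).mpr ha
  have hb' := (mem_map_mk'_subgroupOf h.le ⟨b, h.le_normalizer hb⟩).mpr hb
  exact (mk'_subgroupOf_commute_iff ⟨a, h.le_normalizer ha⟩ ⟨b, h.le_normalizer hb⟩).mp
    (congrArg Subtype.val (h.maximal_abelian.prop.is_comm.comm ⟨_, ha'⟩ ⟨_, hb'⟩))

/-- An element of `N_G(K)` that centralizes `H / K` lies in `H`, because `H / K` is a maximal
abelian subgroup of `N_G(K) / K`. -/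
theorem IsStrongShodaPair.mem_of_commutator_mem (h : IsStrongShodaPair H K) {g : G}
    (hg : g ∈ Subgroup.normalizer (K : Set G)) (hc : ∀ x ∈ H, ⁅g, x⁆ ∈ K) : g ∈ H := by
  set T := Subgroup.normalizer (K : Set G) with hT
  set Q := (H.subgroupOf T).map (QuotientGroup.mk' (K.subgroupOf T))
  set γ := QuotientGroup.mk' (K.subgroupOf T) ⟨g, hg⟩
  have hQ : ∀ q ∈ Q, Commute γ q := by
    rintro _ ⟨x, hx, rfl⟩
    exact (mk'_subgroupOf_commute_iff _ _).mpr (hc x hx)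
  have := h.maximal_abelian.prop
  have hcomm : IsMulCommutative (Subgroup.closure ((Q : Set _) ∪ {γ})) := by
    refine Subgroup.isMulCommutative_closure ?_
    rintro a (ha | rfl) b (hb | rfl)
    · exact congrArg Subtype.val (h.maximal_abelian.prop.is_comm.comm ⟨_, ha⟩ ⟨_, hb⟩)
    · exact (hQ a ha).symm
    · exact hQ b hb
    · rfl
  have hle := h.maximal_abelian.le_of_ge hcomm
    (Set.subset_union_left.trans Subgroup.subset_closure)
  exact (mem_map_mk'_subgroupOf h.le ⟨g, hg⟩).mp
    (hle (Subgroup.subset_closure (Or.inr rfl)))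

/-- The conditions on the quotients `H / K` and `N(K) / K` in the definition of a strong Shoda pair,
restated through elements of `G`. -/
theorem isStrongShodaPair_of_commutator (hKH : K ≤ H) (hn : Subgroup.normalizer (K : Set G) ≤
      Subgroup.normalizer (H : Set G)) (hHK : ⁅H, H⁆ ≤ K)
    (hcyc : ∃ y ∈ H, ∀ x ∈ H, ∃ i : ℤ, x⁻¹ * y ^ i ∈ K)
    (hmax : ∀ g ∈ Subgroup.normalizer (K : Set G), (∀ x ∈ H, ⁅g, x⁆ ∈ K) → g ∈ H)
    (horth : ∀ g : G, g ∉ Subgroup.normalizer (K : Set G) →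
      eps ℚ H K * conjBy (eps ℚ H K) g = 0) : IsStrongShodaPair H K := by
  have hHn : H ≤ Subgroup.normalizer (K : Set G) :=
    le_normalizer_of_commutator_le hHK le_rfl hKH
  set T := Subgroup.normalizer (K : Set G) with hT
  refine ⟨hKH, hHn, (Subgroup.normal_subgroupOf_iff_le_normalizer hHn).mpr hn, ?_, ⟨?_, ?_⟩, horth⟩
  · obtain ⟨y, hy, hgen⟩ := hcyc
    refine ⟨⟨⟨_, (mem_map_mk'_subgroupOf hKH ⟨y, hHn hy⟩).mpr hy⟩, ?_⟩⟩
    rintro ⟨_, x, hx, rfl⟩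
    obtain ⟨i, hi⟩ := hgen x hx
    exact ⟨i, Subtype.ext (QuotientGroup.eq.mpr (Subgroup.mem_subgroupOf.mpr hi)).symm⟩
  · refine ⟨⟨?_⟩⟩
    rintro ⟨_, a, ha, rfl⟩ ⟨_, b, hb, rfl⟩
    exact Subtype.ext ((mk'_subgroupOf_commute_iff a b).mpr
      (hHK (Subgroup.commutator_mem_commutator ha hb)))
  · intro B hB hle q hq
    obtain ⟨g, rfl⟩ := QuotientGroup.mk'_surjective _ q
    refine (mem_map_mk'_subgroupOf hKH g).mpr (hmax g g.2 fun x hx => ?_)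
    have hx' := hle ((mem_map_mk'_subgroupOf hKH ⟨x, hHn hx⟩).mpr hx)
    exact (mk'_subgroupOf_commute_iff g ⟨x, hHn hx⟩).mp
      (congrArg Subtype.val (hB.is_comm.comm ⟨_, hq⟩ ⟨_, hx'⟩))

end StrongShodaPair

/-! ### Traces of linear characters -/

section TraceChar

variable {F L : Type*} [Field F] [Field L] [Algebra F L] {G : Type*} [Group G] [Finite G]
  {H K : Subgroup G}

/-- The `F`-linear map `a ↦ |H|⁻¹ ∑_{h ∈ H} tr_{L / F}(a χ(h)) h⁻¹` from `L` to the group algebra.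
When `L / F` is Galois and generated by the values of `χ`, it is an embedding of the ring `L` as the
component of `FH` on which `H` acts through `χ`, and the identity of that component is the image of
`1`. -/
noncomputable def traceChar (χ : H →* Lˣ) : L →ₗ[F] MonoidAlgebra F G where
  toFun a := (Nat.card H : F)⁻¹ • ∑ᶠ h : H, single (h : G)⁻¹ (Algebra.trace F L (a * χ h))
  map_add' a b := by
    have := Fintype.ofFinite H
    simp only [finsum_eq_sum_of_fintype, add_mul, map_add, single_add, Finset.sum_add_distrib,
      smul_add]
  map_smul' c a := by
    have := Fintype.ofFinite H
    simp only [finsum_eq_sum_of_fintype, smul_mul_assoc, map_smul, ← smul_single,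
      ← Finset.smul_sum, RingHom.id_apply]
    exact smul_comm _ _ _

theorem traceChar_apply [Fintype H] (χ : H →* Lˣ) (a : L) : traceChar (F := F) χ a =
    (Nat.card H : F)⁻¹ • ∑ h : H, single (h : G)⁻¹ (Algebra.trace F L (a * χ h)) := by
  rw [← finsum_eq_sum_of_fintype]; rfl

theorem single_mul_traceChar (χ : H →* Lˣ) (x : H) (a : L) :
    single (x : G) (1 : F) * traceChar χ a = traceChar χ (χ x * a) := by
  have := Fintype.ofFinite H
  rw [traceChar_apply, traceChar_apply, mul_smul_comm, Finset.mul_sum]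
  congr 1
  refine Fintype.sum_equiv (Equiv.mulRight x⁻¹) _ _ fun h => ?_
  have : (χ x : L) * a * χ (h * x⁻¹) = a * χ h := by
    simp only [map_mul, map_inv, Units.val_mul]
    rw [mul_comm _ a, mul_assoc, mul_left_comm (χ x : L), Units.mul_inv, mul_one]
  simp only [Equiv.coe_mulRight, this, single_mul_single, one_mul]
  simp

theorem traceChar_mul_single (χ : H →* Lˣ) (x : H) (a : L) :
    traceChar χ a * single (x : G) (1 : F) = traceChar χ (χ x * a) := by
  have := Fintype.ofFinite H
  rw [traceChar_apply, traceChar_apply, smul_mul_assoc, Finset.sum_mul]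
  congr 1
  refine Fintype.sum_equiv (Equiv.mulLeft x⁻¹) _ _ fun h => ?_
  simp [single_mul_single, mul_assoc, mul_left_comm a]

theorem commute_single_traceChar (χ : H →* Lˣ) (x : H) (a : L) :
    Commute (single (x : G) (1 : F)) (traceChar χ a) :=
  (single_mul_traceChar χ x a).trans (traceChar_mul_single χ x a).symm

/-- `s(a)` lies in the group algebra of `H`, so what commutes with `H` commutes with `s(a)`. -/
theorem commute_traceChar (χ : H →* Lˣ) (a : L) {z : MonoidAlgebra F G}
    (h : ∀ x : H, Commute (single (x : G) (1 : F)) z) : Commute (traceChar χ a) z := by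
  have := Fintype.ofFinite H
  rw [traceChar_apply]
  refine (Commute.sum_left _ _ _ fun x _ => ?_).smul_left _
  rw [← mul_one (Algebra.trace F L _), ← smul_eq_mul, ← smul_single]
  exact (h x⁻¹).smul_left _

theorem coeff_traceChar_of_notMem (χ : H →* Lˣ) (a : L) {g : G} (hg : g ∉ H) :
    (traceChar (F := F) χ a).coeff g = 0 := by
  have := Fintype.ofFinite H
  rw [traceChar_apply, coeff_smul_apply, coeff_sum, Finsupp.finsetSum_apply,
    Finset.sum_eq_zero, smul_zero]
  intro h _
  rw [coeff_single, Finsupp.single_eq_of_ne]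
  rintro rfl
  exact hg (inv_mem h.2)

/-- Conjugating by an element that normalizes `H` conjugates the character. -/
theorem traceChar_mul_single_of_conj {χ χ' : H →* Lˣ} {g : G}
    (hg : g ∈ Subgroup.normalizer (H : Set G))
    (h : ∀ x y : H, (y : G) = g * x * g⁻¹ → χ' x = χ y) (a : L) :
    traceChar χ a * single g (1 : F) = single g 1 * traceChar χ' a := by
  have := Fintype.ofFinite H
  rw [traceChar_apply, traceChar_apply, mul_smul_comm, Finset.mul_sum, smul_mul_assoc,
    Finset.sum_mul]
  congr 1
  refine (Fintype.sum_equiv (Subgroup.normalizerMonoidHom H ⟨g, hg⟩).toEquiv _ _ fun x => ?_).symm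
  have hx : ((Subgroup.normalizerMonoidHom H ⟨g, hg⟩ x : H) : G) = g * x * g⁻¹ := rfl
  rw [h x _ hx]
  change _ = single ((Subgroup.normalizerMonoidHom H ⟨g, hg⟩ x : H) : G)⁻¹
    (Algebra.trace F L (a * χ (Subgroup.normalizerMonoidHom H ⟨g, hg⟩ x))) * _
  rw [hx, single_mul_single, single_mul_single, one_mul, mul_one]
  simp [mul_assoc]

/-- Galois conjugate characters have the same trace maps, up to the automorphism. -/
theorem traceChar_algEquiv {χ χ' : H →* Lˣ} (σ : L ≃ₐ[F] L) (h : ∀ x, σ (χ x) = χ' x) (a : L) :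
    traceChar (F := F) χ' (σ a) = traceChar χ a := by
  have := Fintype.ofFinite H
  simp_rw [traceChar_apply, ← h, ← map_mul, Algebra.trace_eq_of_algEquiv]

variable [CharZero F]

/-- The coefficient of `s(1)` at the identity is `[L : F] / |H|`. -/
theorem coeff_one_traceChar_one_ne_zero [FiniteDimensional F L] (χ : H →* Lˣ) :
    (traceChar (F := F) χ 1).coeff 1 ≠ 0 := by
  have := Fintype.ofFinite H
  rw [traceChar_apply, coeff_smul_apply, coeff_sum, Finsupp.finsetSum_apply,
    Finset.sum_eq_single 1]
  · have h1 : Algebra.trace F L 1 = Module.finrank F L := by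
      simpa using Algebra.trace_algebraMap (S := L) (1 : F)
    simp [h1, Module.finrank_pos.ne']
  · intro b _ hb
    rw [coeff_single, Finsupp.single_eq_of_ne]
    simpa [eq_comm] using hb
  · simp

theorem traceChar_one_ne_zero [FiniteDimensional F L] (χ : H →* Lˣ) :
    traceChar (F := F) χ 1 ≠ 0 := fun h => coeff_one_traceChar_one_ne_zero (F := F) χ (by simp [h])

theorem sum_units_hom_eq_zero {M : Type*} [Group M] [Fintype M] {χ : M →* Lˣ} (h : χ ≠ 1) :
    ∑ m : M, (χ m : L) = 0 :=
  sum_hom_units_eq_zero ((Units.coeHom L).comp χ) fun h' =>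
    h (MonoidHom.ext fun m => Units.ext (DFunLike.congr_fun h' m))

open scoped Classical in
/-- Orthogonality of characters, as the product of the images of the two trace maps: `∑ σ(a)`, over
the automorphisms `σ` of `L / F` that carry `χ'` to `χ`, is what remains of `a`. -/
theorem traceChar_mul_traceChar_of_galois [FiniteDimensional F L] [IsGalois F L] (χ' χ : H →* Lˣ)
    (a b : L) : traceChar (F := F) χ' a * traceChar χ b =
      traceChar χ ((∑ σ : L ≃ₐ[F] L, if ∀ h, σ (χ' h) = χ h then σ a else 0) * b) := by
  have := Fintype.ofFinite H
  have hc : (Nat.card H : F) ≠ 0 := Nat.cast_ne_zero.mpr Nat.card_pos.ne'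
  have hL : (Nat.card H : L) ≠ 0 := by
    have := (algebraMap F L).injective.ne hc
    simpa using this
  have h1 : traceChar (F := F) χ' a * traceChar χ b = traceChar χ ((Nat.card H : F)⁻¹ •
      ∑ h : H, Algebra.trace F L (a * χ' h) • ((χ h⁻¹ : L) * b)) := by
    rw [traceChar_apply χ', smul_mul_assoc, Finset.sum_mul, map_smul, map_sum]
    congr 1
    refine Finset.sum_congr rfl fun h _ => ?_
    rw [map_smul, ← single_mul_traceChar, ← smul_mul_assoc, smul_single]
    simp
  rw [h1]
  congr 1
  have h2 : ∀ h : H, Algebra.trace F L (a * χ' h) • ((χ h⁻¹ : L) * b) =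
      ∑ σ : L ≃ₐ[F] L, σ a * (σ (χ' h) * (χ h⁻¹ : L)) * b := fun h => by
    rw [Algebra.smul_def, trace_eq_sum_automorphisms, Finset.sum_mul]
    refine Finset.sum_congr rfl fun σ _ => ?_
    rw [map_mul]; ring
  simp_rw [h2]
  rw [Finset.sum_comm, Finset.sum_mul, Finset.smul_sum]
  refine Finset.sum_congr rfl fun σ _ => ?_
  rw [← Finset.sum_mul, ← Finset.mul_sum]
  split_ifs with hσ
  · have : ∀ h, σ (χ' h) * (χ h⁻¹ : L) = 1 := fun h => by
      rw [hσ h, ← Units.val_mul, ← map_mul, mul_inv_cancel, map_one, Units.val_one]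
    simp only [this, Finset.sum_const, Finset.card_univ, ← Nat.card_eq_fintype_card, nsmul_eq_mul,
      mul_one]
    rw [Algebra.smul_def, map_inv₀, map_natCast]
    field_simp
  · have hne : (Units.map (σ : L →* L)).comp χ' * χ⁻¹ ≠ 1 := fun h => hσ fun x =>
      congrArg Units.val (mul_inv_eq_one.mp (DFunLike.congr_fun h x))
    have h3 : ∑ x : H, σ (χ' x) * (χ x⁻¹ : L) = 0 := by
      rw [← sum_units_hom_eq_zero hne]
      exact Finset.sum_congr rfl fun x _ => by rw [map_inv]; rfl
    rw [h3]
    simp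

omit [Finite G] [CharZero F] in
/-- An automorphism is determined by its effect on the values of `χ`, if these generate `L`. -/
theorem algEquiv_ext_of_adjoin {χ : H →* Lˣ}
    (hgen : Algebra.adjoin F (Set.range fun h => (χ h : L)) = ⊤) {σ τ : L ≃ₐ[F] L}
    (h : ∀ x, σ (χ x) = τ (χ x)) : σ = τ := by
  have : (σ : L →ₐ[F] L) = τ :=
    AlgHom.ext_of_adjoin_eq_top hgen (by rintro _ ⟨x, rfl⟩; exact h x)
  exact AlgEquiv.ext fun a => DFunLike.congr_fun this a

variable [FiniteDimensional F L] [IsGalois F L] {χ : H →* Lˣ}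

/-- The trace map is multiplicative: when the values of `χ` generate `L`, only the identity carries
`χ` to `χ`, and one term is left in `traceChar_mul_traceChar_of_galois`. -/
theorem traceChar_mul_traceChar (hgen : Algebra.adjoin F (Set.range fun h => (χ h : L)) = ⊤)
    (a b : L) : traceChar (F := F) χ a * traceChar χ b = traceChar χ (a * b) := by
  classical
  rw [traceChar_mul_traceChar_of_galois, Finset.sum_eq_single 1]
  · simp
  · intro σ _ hσ
    exact if_neg fun h => hσ (algEquiv_ext_of_adjoin hgen h)
  · simp

theorem traceChar_eq_zero_iff (hgen : Algebra.adjoin F (Set.range fun h => (χ h : L)) = ⊤) {a : L} :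
    traceChar (F := F) χ a = 0 ↔ a = 0 := by
  refine ⟨fun h => by_contra fun ha => traceChar_one_ne_zero (F := F) χ ?_, fun h => by simp [h]⟩
  rw [← mul_inv_cancel₀ ha, ← traceChar_mul_traceChar hgen, h, zero_mul]

omit [IsGalois F L] [FiniteDimensional F L] in
theorem traceChar_mul_hat_self (hK : ∀ h : H, χ h = 1 ↔ (h : G) ∈ K) (hKH : K ≤ H) (a : L) :
    traceChar χ a * hat F K = traceChar χ a :=
  mul_hat_of_forall fun m hm => by
    have h1 := traceChar_mul_single (F := F) χ ⟨m, hKH hm⟩ a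
    rwa [(hK _).mpr hm, Units.val_one, one_mul] at h1

omit [IsGalois F L] [FiniteDimensional F L] [CharZero F] in
/-- `χ` restricts to a nontrivial character of `M`, whose values add up to zero. -/
theorem traceChar_mul_hat_eq_zero (hK : ∀ h : H, χ h = 1 ↔ (h : G) ∈ K) {M : Subgroup G}
    (hMH : M ≤ H) (hMK : ¬ M ≤ K) (a : L) : traceChar χ a * hat F M = 0 := by
  have := Fintype.ofFinite M
  have hne : χ.comp (Subgroup.inclusion hMH) ≠ 1 := fun h => hMK fun m hm =>
    (hK ⟨m, hMH hm⟩).mp (DFunLike.congr_fun h ⟨m, hm⟩)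
  have hm : ∀ m : M, traceChar χ a * single (m : G) (1 : F) =
      traceChar χ (χ.comp (Subgroup.inclusion hMH) m * a) := fun m =>
    traceChar_mul_single χ (Subgroup.inclusion hMH m) a
  rw [hat_eq_sum, mul_smul_comm, Finset.mul_sum, Finset.sum_congr rfl fun m _ => hm m,
    ← map_sum, ← Finset.sum_mul, sum_units_hom_eq_zero hne, zero_mul, map_zero, smul_zero]

omit [IsGalois F L] [FiniteDimensional F L] in
theorem traceChar_mul_eps (hK : ∀ h : H, χ h = 1 ↔ (h : G) ∈ K) (hKH : K ≤ H) (a : L) :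
    traceChar χ a * eps F H K = traceChar χ a :=
  mul_eps_eq_self (traceChar_mul_hat_self hK hKH a) fun _ hM =>
    traceChar_mul_hat_eq_zero hK hM.prop.2.1 hM.prop.1.not_ge a

omit [IsGalois F L] [FiniteDimensional F L] in
theorem eps_mul_traceChar (hK : ∀ h : H, χ h = 1 ↔ (h : G) ∈ K) (hKH : K ≤ H)
    (hn : H ≤ Subgroup.normalizer (K : Set G)) (a : L) :
    eps F H K * traceChar χ a = traceChar χ a := by
  rw [← (commute_traceChar χ a fun x => commute_single_eps hn x.2).eq, traceChar_mul_eps hK hKH]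

omit [IsGalois F L] [FiniteDimensional F L] in
/-- Outside `N(K)` the orthogonality of conjugates comes from that of `ε(H, K)`, of which all `s(a)`
are multiples. -/
theorem IsStrongShodaPair.traceChar_mul_single_mul_traceChar (h : IsStrongShodaPair H K)
    (hK : ∀ h : H, χ h = 1 ↔ (h : G) ∈ K) {g : G} (hg : g ∉ Subgroup.normalizer (K : Set G))
    (a b : L) : traceChar χ a * single g (1 : F) * traceChar χ b = 0 := by
  have h1 := congrArg (mapRingHom G (algebraMap ℚ F)) (h.orthogonal g⁻¹ (by simpa using hg))
  rw [conjBy, inv_inv, map_mul, map_mul, map_mul, map_eps, mapRingHom_single, mapRingHom_single,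
    map_one, map_zero] at h1
  have h2 : eps F H K * single g (1 : F) * eps F H K = 0 := by
    have := congrArg (· * single g (1 : F)) h1
    simpa [mul_assoc, single_mul_single, ← one_def] using this
  rw [← traceChar_mul_eps hK h.le a, ← eps_mul_traceChar hK h.le h.le_normalizer b]
  rw [show traceChar χ a * eps F H K * single g 1 * (eps F H K * traceChar χ b) =
    traceChar χ a * (eps F H K * single g 1 * eps F H K) * traceChar χ b by simp only [mul_assoc],
    h2, mul_zero, zero_mul]

/-- The character `x ↦ χ(g x g⁻¹)` of a subgroup that `g` normalizes. -/
def conjHom (χ : H →* Lˣ) {g : G} (hg : g ∈ Subgroup.normalizer (H : Set G)) : H →* Lˣ :=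
  χ.comp (Subgroup.normalizerMonoidHom H ⟨g, hg⟩).toMonoidHom

omit [IsGalois F L] [FiniteDimensional F L] [CharZero F] in
/-- If `g` turns `χ` into its Galois conjugate `σ ∘ χ`, then conjugation by `g` induces `σ⁻¹` on the
image of `s`. -/
theorem traceChar_mul_single_of_algEquiv {g : G} (hg : g ∈ Subgroup.normalizer (H : Set G))
    {σ : L ≃ₐ[F] L} (h : ∀ x, conjHom χ hg x = σ (χ x)) (a : L) :
    traceChar χ (σ a) * single g (1 : F) = single g 1 * traceChar χ a := by
  rw [traceChar_mul_single_of_conj hg (χ' := conjHom χ hg)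
    fun x y hxy => congrArg χ (Subtype.ext hxy.symm),
    traceChar_algEquiv σ fun x => (h x).symm]

/-- In `N(H)`, but outside the stabilizer of the Galois orbit of `χ`, conjugates are orthogonal by
orthogonality of characters. -/
theorem traceChar_mul_single_mul_traceChar_eq_zero {g : G}
    (hg : g ∈ Subgroup.normalizer (H : Set G))
    (h : ¬ ∃ σ : L ≃ₐ[F] L, ∀ x, conjHom χ hg x = σ (χ x)) (a b : L) :
    traceChar χ a * single g (1 : F) * traceChar χ b = 0 := by
  classical
  rw [traceChar_mul_single_of_conj hg (χ' := conjHom χ hg)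
    fun x y hxy => congrArg χ (Subtype.ext hxy.symm), mul_assoc,
    traceChar_mul_traceChar_of_galois, Finset.sum_eq_zero, zero_mul, map_zero, mul_zero]
  intro σ _
  exact if_neg fun hσ => h ⟨σ.symm, fun x => by rw [← hσ, σ.symm_apply_apply]⟩

end TraceChar

/-! ### Sums of orthogonal conjugates of an idempotent -/

section ConjSum

variable {F : Type*} [Field F] {G : Type*} [Group G]

theorem single_mul_single_one (g h : G) :
    single g (1 : F) * single h 1 = single (g * h) 1 := by
  rw [single_mul_single, one_mul]

theorem single_mul_single_inv (g : G) : single g (1 : F) * single g⁻¹ 1 = 1 := by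
  rw [single_mul_single_one, mul_inv_cancel, one_def]

theorem single_inv_mul_single (g : G) : single g⁻¹ (1 : F) * single g 1 = 1 := by
  rw [single_mul_single_one, inv_mul_cancel, one_def]

theorem commute_of_forall_single {z w : MonoidAlgebra F G}
    (h : ∀ g, Commute (single g (1 : F)) w) : Commute z w := by
  induction z using MonoidAlgebra.induction_linear with
  | zero => exact Commute.zero_left w
  | add f g hf hg => exact hf.add_left hg
  | single g c =>
    rw [← mul_one c, ← smul_eq_mul, ← smul_single]
    exact (h g).smul_left c

/-- `ε` is a nonzero idempotent of the group algebra which commutes with the elements of `E` and is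
orthogonal to its conjugates under the elements outside `E`. -/
structure HasOrthogonalConjugates (E : Subgroup G) (ε : MonoidAlgebra F G) : Prop where
  idem : ε * ε = ε
  ne_zero : ε ≠ 0
  comm : ∀ g ∈ E, Commute (single g (1 : F)) ε
  off : ∀ g ∉ E, ε * single g (1 : F) * ε = 0

variable {ι : Type*} [Fintype ι] {t : ι → G} {E : Subgroup G} {ε : MonoidAlgebra F G}

/-- The sum of the conjugates `t_i ε t_i⁻¹`. For a system `t` of representatives of the left cosets
of `E`, and `ε` with orthogonal conjugates outside `E`, it is the sum of the different conjugates of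
`ε`. -/
noncomputable def conjSum (t : ι → G) (ε : MonoidAlgebra F G) : MonoidAlgebra F G :=
  ∑ i, single (t i) 1 * ε * single (t i)⁻¹ 1

namespace HasOrthogonalConjugates

/-- Left multiplication by `g` permutes the conjugates `t_i ε t_i⁻¹` in the same way as `g` permutes
the cosets `t_i E`. -/
theorem single_mul_conj (h : HasOrthogonalConjugates E ε) {g a b : G} (hab : b⁻¹ * (g * a) ∈ E) :
    single g (1 : F) * (single a 1 * ε * single a⁻¹ 1) =
      single b 1 * ε * single b⁻¹ 1 * single g 1 := by
  have h1 : single g (1 : F) * single a 1 = single b 1 * single (b⁻¹ * (g * a)) 1 := by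
    simp
  have h2 : single (b⁻¹ * (g * a)) 1 * single a⁻¹ (1 : F) = single b⁻¹ 1 * single g 1 := by
    simp [mul_assoc]
  rw [mul_assoc _ (single b⁻¹ 1), ← h2, ← mul_assoc, ← mul_assoc, h1, mul_assoc _ _ ε,
    (h.comm _ hab).eq]
  simp only [mul_assoc]

theorem mul_conj_of_notMem (h : HasOrthogonalConjugates E ε) {a b : G} (hab : a⁻¹ * b ∉ E) :
    ε * single a⁻¹ (1 : F) * single b 1 * ε = 0 := by
  rw [mul_assoc ε, single_mul_single_one, h.off _ hab]

theorem commute_conjSum (h : HasOrthogonalConjugates E ε)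
    (ht : Function.Bijective fun i => (t i : G ⧸ E)) (z : MonoidAlgebra F G) :
    Commute z (conjSum t ε) := by
  refine commute_of_forall_single fun g => ?_
  rw [commute_iff_eq, conjSum, Finset.mul_sum, Finset.sum_mul]
  let u := Equiv.ofBijective _ ht
  refine Fintype.sum_equiv ((u.trans (MulAction.toPerm g)).trans u.symm) _ _ fun i =>
    h.single_mul_conj ?_
  rw [← QuotientGroup.eq]
  exact u.apply_symm_apply (g • u i)

theorem mul_conjSum (h : HasOrthogonalConjugates E ε)
    (ht : Function.Bijective fun i => (t i : G ⧸ E)) (i : ι) :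
    ε * single (t i)⁻¹ 1 * conjSum t ε = ε * single (t i)⁻¹ 1 := by
  rw [conjSum, Finset.mul_sum, Finset.sum_eq_single i]
  · rw [← mul_assoc, ← mul_assoc, mul_assoc ε, single_inv_mul_single, mul_one, h.idem]
  · intro j _ hj
    rw [← mul_assoc, ← mul_assoc, h.mul_conj_of_notMem, zero_mul]
    rw [← QuotientGroup.eq]
    exact fun h => hj (ht.1 h).symm
  · simp

theorem mul_conjSum_self (h : HasOrthogonalConjugates E ε)
    (ht : Function.Bijective fun i => (t i : G ⧸ E)) : ε * conjSum t ε = ε := by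
  obtain ⟨i, hi⟩ := ht.2 (1 : G)
  have hi' : t i ∈ E := by simpa using QuotientGroup.eq.mp hi
  have h1 := congrArg (single (t i) 1 * ·) (h.mul_conjSum ht i)
  simp only [← mul_assoc, (h.comm _ hi').eq] at h1
  simpa only [mul_assoc ε, single_mul_single_inv, mul_one] using h1

theorem conjSum_ne_zero (h : HasOrthogonalConjugates E ε)
    (ht : Function.Bijective fun i => (t i : G ⧸ E)) : conjSum t ε ≠ 0 := fun h0 => by
  have := h.mul_conjSum_self ht
  rw [h0, mul_zero] at this
  exact h.ne_zero this.symm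

theorem conjSum_mul_conjSum (h : HasOrthogonalConjugates E ε)
    (ht : Function.Bijective fun i => (t i : G ⧸ E)) :
    conjSum t ε * conjSum t ε = conjSum t ε := by
  nth_rw 1 [conjSum]
  rw [Finset.sum_mul]
  refine Finset.sum_congr rfl fun i _ => ?_
  rw [mul_assoc, mul_assoc, ← mul_assoc ε, h.mul_conjSum ht, mul_assoc]

/-- A central element that annihilates `ε` annihilates its conjugates. -/
theorem mul_conjSum_eq_zero {z : MonoidAlgebra F G} (hz : ∀ w, Commute z w) (h0 : z * ε = 0) :
    z * conjSum t ε = 0 := by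
  rw [conjSum, Finset.mul_sum]
  refine Finset.sum_eq_zero fun i _ => ?_
  rw [← mul_assoc, ← mul_assoc, (hz _).eq, mul_assoc _ z, h0, mul_zero, zero_mul]

/-- `conjSum t ε` is primitive if multiplication by `ε` sends every central idempotent to `0`
or to `ε`. -/
theorem isPrimitiveCentralIdempotent (h : HasOrthogonalConjugates E ε)
    (ht : Function.Bijective fun i => (t i : G ⧸ E))
    (hz : ∀ z : MonoidAlgebra F G, (∀ w, Commute z w) → z * z = z → z * ε = 0 ∨ z * ε = ε) :
    IsPrimitiveCentralIdempotent (conjSum t ε) where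
  idem := h.conjSum_mul_conjSum ht
  central := Semigroup.mem_center_iff.mpr fun z => (h.commute_conjSum ht z).eq
  ne_zero := h.conjSum_ne_zero ht
  primitive e₁ e₂ h₁ h₂ hc₁ hc₂ h12 hadd := by
    have hc₁' : ∀ w, Commute e₁ w := fun w => (Semigroup.mem_center_iff.mp hc₁ w).symm
    have hc₂' : ∀ w, Commute e₂ w := fun w => (Semigroup.mem_center_iff.mp hc₂ w).symm
    have k₁ : e₁ * conjSum t ε = e₁ := by rw [← hadd, mul_add, h12, h₁.eq, add_zero]
    have k₂ : e₂ * conjSum t ε = e₂ := by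
      rw [← hadd, mul_add, (hc₂' e₁).eq, h12, h₂.eq, zero_add]
    rcases hz e₁ hc₁' h₁ with h0 | h0
    · exact Or.inl (k₁.symm.trans (mul_conjSum_eq_zero hc₁' h0))
    · refine Or.inr (k₂.symm.trans (mul_conjSum_eq_zero hc₂' ?_))
      rw [← h0, ← mul_assoc, (hc₂' e₁).eq, h12, zero_mul]

/-- The conjugates `t_i ε t_i⁻¹` are the different conjugates of `ε`. -/
theorem sum_range_conjBy [Finite G] (h : HasOrthogonalConjugates E ε)
    (ht : Function.Bijective fun i => (t i : G ⧸ E)) :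
    ∑ x ∈ (Set.finite_range fun g : G => conjBy ε g).toFinset, x = conjSum t ε := by
  classical
  have hconj : ∀ a b : G, b⁻¹ * a ∈ E →
      single a (1 : F) * ε * single a⁻¹ 1 = single b 1 * ε * single b⁻¹ 1 := fun a b hab => by
    have := h.single_mul_conj (g := 1) (a := a) (b := b) (by simpa using hab)
    simpa [← one_def] using this
  have himage : (Set.finite_range fun g : G => conjBy ε g).toFinset =
      Finset.univ.image fun i => single (t i) (1 : F) * ε * single (t i)⁻¹ 1 := by
    ext x
    simp only [Set.Finite.mem_toFinset, Set.mem_range, Finset.mem_image, Finset.mem_univ, true_and]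
    constructor
    · rintro ⟨g, rfl⟩
      obtain ⟨i, hi⟩ := ht.2 (g⁻¹ : G)
      refine ⟨i, ?_⟩
      rw [hconj (t i) g⁻¹ (QuotientGroup.eq.mp hi.symm), conjBy, inv_inv]
    · rintro ⟨i, rfl⟩
      exact ⟨(t i)⁻¹, by rw [conjBy, inv_inv]⟩
  rw [himage, Finset.sum_image, conjSum]
  intro i _ j _ hij
  refine ht.1 (QuotientGroup.eq.mpr (by_contra fun hn => h.ne_zero ?_))
  have h1 := congrArg (fun x => ε * single (t i)⁻¹ 1 * x * single (t i) 1) hij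
  simp only [← mul_assoc] at h1
  rw [h.mul_conj_of_notMem hn, zero_mul, zero_mul, mul_assoc ε, single_inv_mul_single, mul_one,
    h.idem, mul_assoc, single_inv_mul_single, mul_one] at h1
  exact h1

end HasOrthogonalConjugates

end ConjSum

/-! ### Crossed products inside the group algebra -/

section CrossedEmbedding

variable {F L : Type*} [Field F] [Field L] [Algebra F L] {G : Type*} [Group G] [Finite G]
  {H E : Subgroup G}

/-- The linear map `∑ u_x a_x ↦ ∑ φ(x) s(a_x)`, where `s` is the trace map of `χ`. -/
noncomputable def crossedEmbedding (χ : H →* Lˣ) (φ : E ⧸ H.subgroupOf E → E) :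
    (E ⧸ H.subgroupOf E →₀ L) →ₗ[F] MonoidAlgebra F G :=
  Finsupp.lsum F fun x => LinearMap.mulLeft F (single (φ x : G) 1) ∘ₗ traceChar χ

variable [(H.subgroupOf E).Normal] {χ : H →* Lˣ} {φ : E ⧸ H.subgroupOf E → E}

omit [(H.subgroupOf E).Normal] in
theorem crossedEmbedding_single (x : E ⧸ H.subgroupOf E) (a : L) :
    crossedEmbedding (F := F) χ φ (Finsupp.single x a) = single (φ x : G) 1 * traceChar χ a := by
  simp [crossedEmbedding]

omit [(H.subgroupOf E).Normal] in
theorem crossedEmbedding_apply [Fintype (E ⧸ H.subgroupOf E)] (w : E ⧸ H.subgroupOf E →₀ L) :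
    crossedEmbedding (F := F) χ φ w = ∑ x, single (φ x : G) 1 * traceChar χ (w x) := by
  rw [crossedEmbedding, Finsupp.lsum_apply, Finsupp.sum_fintype _ _ (by simp)]
  rfl

omit [Finite G] [(H.subgroupOf E).Normal] in
theorem mk_eq_iff_inv_mul_mem {g g' : E} :
    (g : E ⧸ H.subgroupOf E) = g' ↔ (g : G)⁻¹ * g' ∈ H := by
  rw [QuotientGroup.eq, Subgroup.mem_subgroupOf]
  rfl

omit [(H.subgroupOf E).Normal] in
/-- The products `φ(x) s(a_x)` have their supports in the different cosets of `H`. -/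
theorem coeff_crossedEmbedding (hφ : ∀ x, (φ x : E ⧸ H.subgroupOf E) = x)
    (w : E ⧸ H.subgroupOf E →₀ L) (y : E ⧸ H.subgroupOf E) {h : G} (hh : h ∈ H) :
    (crossedEmbedding (F := F) χ φ w).coeff (φ y * h) = (traceChar (F := F) χ (w y)).coeff h := by
  induction w using Finsupp.induction_linear with
  | zero => simp
  | add f g hf hg => simp [hf, hg]
  | single x a =>
    rw [crossedEmbedding_single, coeff_single_mul_apply, one_mul]
    by_cases hxy : x = y
    · subst hxy
      simp
    · rw [Finsupp.single_eq_of_ne (Ne.symm hxy), map_zero, coeff_traceChar_of_notMem]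
      · simp
      · intro hmem
        rw [← mul_assoc] at hmem
        refine hxy ?_
        rw [← hφ x, ← hφ y, mk_eq_iff_inv_mul_mem]
        exact (H.mul_mem_cancel_right hh).mp hmem

variable [CharZero F] [FiniteDimensional F L] [IsGalois F L]

omit [(H.subgroupOf E).Normal] in
theorem crossedEmbedding_injective (hφ : ∀ x, (φ x : E ⧸ H.subgroupOf E) = x)
    (hgen : Algebra.adjoin F (Set.range fun h => (χ h : L)) = ⊤) :
    Function.Injective (crossedEmbedding (F := F) χ φ) := by
  refine (injective_iff_map_eq_zero _).mpr fun w hw => Finsupp.ext fun y => ?_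
  refine (traceChar_eq_zero_iff (F := F) hgen).mp (MonoidAlgebra.ext (Finsupp.ext fun g => ?_))
  by_cases hg : g ∈ H
  · rw [← coeff_crossedEmbedding hφ w y hg, hw]
    rfl
  · rw [coeff_traceChar_of_notMem χ _ hg]
    rfl

omit [CharZero F] [FiniteDimensional F L] [IsGalois F L] [(H.subgroupOf E).Normal] in
theorem exists_crossedEmbedding_single_eq
    (hφ : ∀ x, (φ x : E ⧸ H.subgroupOf E) = x) {g : G} (hg : g ∈ E) (a : L) :
    ∃ w, crossedEmbedding (F := F) χ φ w = single g 1 * traceChar χ a := by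
  have hmem : (φ (⟨g, hg⟩ : E) : G)⁻¹ * g ∈ H := by
    have := mk_eq_iff_inv_mul_mem.mp (hφ ((⟨g, hg⟩ : E) : E ⧸ H.subgroupOf E))
    exact this
  refine ⟨Finsupp.single ((⟨g, hg⟩ : E) : E ⧸ H.subgroupOf E) (χ ⟨_, hmem⟩ * a), ?_⟩
  rw [crossedEmbedding_single, ← single_mul_traceChar, ← mul_assoc, single_mul_single_one]
  simp

omit [CharZero F] [FiniteDimensional F L] [IsGalois F L] [(H.subgroupOf E).Normal] in
/-- The range of the crossed embedding contains `ε FG ε`: a group element outside `E` is annihilated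
by multiplication with `ε` on both sides. -/
theorem exists_crossedEmbedding_eq (hφ : ∀ x, (φ x : E ⧸ H.subgroupOf E) = x)
    (hε : HasOrthogonalConjugates E (traceChar (F := F) χ 1)) (z : MonoidAlgebra F G) :
    ∃ w, crossedEmbedding (F := F) χ φ w = traceChar χ 1 * z * traceChar χ 1 := by
  induction z using MonoidAlgebra.induction_linear with
  | zero => exact ⟨0, by simp⟩
  | add f g hf hg =>
    obtain ⟨w, hw⟩ := hf
    obtain ⟨w', hw'⟩ := hg
    exact ⟨w + w', by rw [map_add, hw, hw', mul_add, add_mul]⟩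
  | single g c =>
    rw [show single g c = c • single g (1 : F) by simp]
    by_cases hg : g ∈ E
    · obtain ⟨w, hw⟩ := exists_crossedEmbedding_single_eq (F := F) (χ := χ) hφ hg 1
      refine ⟨c • w, ?_⟩
      rw [map_smul, hw, mul_smul_comm, smul_mul_assoc, ← (hε.comm g hg).eq, mul_assoc, hε.idem]
    · exact ⟨0, by rw [mul_smul_comm, smul_mul_assoc, hε.off g hg]; simp⟩

/-- The centre of the component of the group algebra belonging to `χ` embeds in `L`, because `E / H`
acts faithfully on `L`. -/
theorem exists_mul_traceChar_one_eq (hφ : ∀ x, (φ x : E ⧸ H.subgroupOf E) = x)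
    (hgen : Algebra.adjoin F (Set.range fun h => (χ h : L)) = ⊤)
    (hε : HasOrthogonalConjugates E (traceChar (F := F) χ 1)) {σ : E ⧸ H.subgroupOf E → (L ≃ₐ[F] L)}
    (hσ : ∀ x (a : L), traceChar (F := F) χ a * single (φ x : G) 1 =
      single (φ x : G) 1 * traceChar χ (σ x a))
    (hfaith : ∀ x, σ x = 1 → x = 1) {z : MonoidAlgebra F G} (hz : ∀ w, Commute z w) :
    ∃ a, z * traceChar χ 1 = traceChar (F := F) χ a := by
  obtain ⟨w, hw⟩ := exists_crossedEmbedding_eq (χ := χ) hφ hε z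
  have hw' : crossedEmbedding χ φ w = z * traceChar χ 1 := by
    rw [hw, ← (hz _).eq, mul_assoc, hε.idem]
  have hcomm : ∀ b x, σ x b * w x = w x * b := by
    have := Fintype.ofFinite (E ⧸ H.subgroupOf E)
    intro b
    have h1 : crossedEmbedding (F := F) χ φ (Finsupp.equivFunOnFinite.symm fun x => σ x b * w x) =
        crossedEmbedding χ φ (Finsupp.equivFunOnFinite.symm fun x => w x * b) := by
      have hl : crossedEmbedding (F := F) χ φ (Finsupp.equivFunOnFinite.symm fun x => σ x b * w x) =
          traceChar χ b * crossedEmbedding χ φ w := by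
        simp only [crossedEmbedding_apply, Finset.mul_sum, Finsupp.coe_equivFunOnFinite_symm]
        refine Finset.sum_congr rfl fun x _ => ?_
        rw [← mul_assoc, hσ, mul_assoc, traceChar_mul_traceChar hgen]
      have hr : crossedEmbedding (F := F) χ φ (Finsupp.equivFunOnFinite.symm fun x => w x * b) =
          crossedEmbedding χ φ w * traceChar χ b := by
        simp only [crossedEmbedding_apply, Finset.sum_mul, Finsupp.coe_equivFunOnFinite_symm]
        refine Finset.sum_congr rfl fun x _ => ?_
        rw [mul_assoc, traceChar_mul_traceChar hgen]
      rw [hl, hr, hw', mul_assoc, ← mul_assoc, ← (hz _).eq, mul_assoc, traceChar_mul_traceChar hgen,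
        traceChar_mul_traceChar hgen, one_mul, mul_one]
    have h2 := crossedEmbedding_injective hφ hgen h1
    exact fun x => DFunLike.congr_fun h2 x
  have hsupp : w = Finsupp.single 1 (w 1) := by
    ext x
    by_cases hx : x = 1
    · subst hx; simp
    · rw [Finsupp.single_eq_of_ne hx]
      by_contra h0
      refine hx (hfaith x (AlgEquiv.ext fun b => ?_))
      have := hcomm b x
      rw [mul_comm (w x)] at this
      exact mul_right_cancel₀ h0 this
  have h1 : (φ 1 : G) ∈ H := by
    have := mk_eq_iff_inv_mul_mem.mp (show ((1 : E) : E ⧸ H.subgroupOf E) = φ 1 from (hφ 1).symm)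
    simpa using this
  refine ⟨χ ⟨_, h1⟩ * w 1, ?_⟩
  rw [← hw', hsupp, crossedEmbedding_single, single_mul_traceChar χ ⟨_, h1⟩]
  simp

variable {S : CrossedSystem F L (E ⧸ H.subgroupOf E)}

/-- The relations `s(a) φ(x) = φ(x) s(σ_x(a))` and `φ(x) φ(y) s(a) = φ(xy) s(τ(x, y) a)` are those
of the crossed product. -/
theorem crossedEmbedding_mulHom (hgen : Algebra.adjoin F (Set.range fun h => (χ h : L)) = ⊤)
    (hσ : ∀ x (a : L), traceChar (F := F) χ a * single (φ x : G) 1 =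
      single (φ x : G) 1 * traceChar χ (S.σ x a))
    (hτ : ∀ x y (a : L), single (φ x * φ y : G) (1 : F) * traceChar χ a =
      single (φ (x * y) : G) 1 * traceChar χ (S.τ x y * a)) (v w : E ⧸ H.subgroupOf E →₀ L) :
    crossedEmbedding χ φ (S.mulHom v w) =
      crossedEmbedding (F := F) χ φ v * crossedEmbedding χ φ w := by
  induction v using Finsupp.induction_linear with
  | zero => simp
  | add f g hf hg => simp only [map_add, LinearMap.add_apply, hf, hg, add_mul]
  | single x a =>
  induction w using Finsupp.induction_linear with
  | zero => simp
  | add f g hf hg => simp only [map_add, hf, hg, mul_add]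
  | single y b =>
  rw [S.mulHom_single, crossedEmbedding_single, crossedEmbedding_single, crossedEmbedding_single,
    ← hτ, ← traceChar_mul_traceChar hgen, ← single_mul_single_one, mul_assoc, mul_assoc,
    ← mul_assoc (traceChar χ a), hσ, ← mul_assoc (single (φ y : G) 1)]

omit [CharZero F] [FiniteDimensional F L] [IsGalois F L] in
theorem crossedEmbedding_one
    (hτ : ∀ x y (a : L), single (φ x * φ y : G) (1 : F) * traceChar χ a =
      single (φ (x * y) : G) 1 * traceChar χ (S.τ x y * a)) :
    crossedEmbedding (F := F) χ φ (1 : S.Product) = traceChar χ 1 := by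
  have h1 := hτ 1 1 ((S.τ 1 1)⁻¹ : Lˣ)
  rw [Units.mul_inv, mul_one, ← single_mul_single_one, mul_assoc] at h1
  have h2 := congrArg (single (φ 1 : G)⁻¹ (1 : F) * ·) h1
  simp only [← mul_assoc, single_inv_mul_single, one_mul] at h2
  exact (crossedEmbedding_single _ _).trans h2

end CrossedEmbedding

/-! ### The component as a matrix algebra -/

section MatrixComponent

variable {F : Type*} [Field F] {G : Type*} [Group G] {ι : Type*} [Fintype ι] {t : ι → G}
  {E : Subgroup G} {ε : MonoidAlgebra F G} {P : Type*} [Ring P] [Algebra F P]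

/-- The map `(p_{ij}) ↦ ∑ t_i θ(p_{ij}) t_j⁻¹`. -/
noncomputable def matrixMap (t : ι → G) (θ : P →ₗ[F] MonoidAlgebra F G) :
    Matrix ι ι P →ₗ[F] MonoidAlgebra F G where
  toFun M := ∑ i, ∑ j, single (t i) 1 * θ (M i j) * single (t j)⁻¹ 1
  map_add' M N := by
    simp only [Matrix.add_apply, map_add, mul_add, add_mul, Finset.sum_add_distrib]
  map_smul' c M := by
    simp only [Matrix.smul_apply, map_smul, mul_smul_comm, smul_mul_assoc, Finset.smul_sum,
      RingHom.id_apply]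

theorem matrixMap_apply (θ : P →ₗ[F] MonoidAlgebra F G) (M : Matrix ι ι P) :
    matrixMap t θ M = ∑ i, ∑ j, single (t i) 1 * θ (M i j) * single (t j)⁻¹ 1 := rfl

theorem matrixMap_single [DecidableEq ι] (θ : P →ₗ[F] MonoidAlgebra F G) (i j : ι) (p : P) :
    matrixMap t θ (Matrix.single i j p) = single (t i) 1 * θ p * single (t j)⁻¹ 1 := by
  rw [matrixMap_apply, Finset.sum_eq_single i, Finset.sum_eq_single j]
  · simp
  · intro j' _ hj
    simp [Ne.symm hj]
  · simp
  · intro i' _ hi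
    simp [Ne.symm hi]
  · simp

variable {θ : P →ₗ[F] MonoidAlgebra F G}

/-- Multiplication by `θ(p) t_k⁻¹` on the left extracts the `k`-th row of a matrix. -/
theorem mul_conj_matrixMap (h : HasOrthogonalConjugates E ε)
    (ht : Function.Bijective fun i => (t i : G ⧸ E)) (hmul : ∀ p q, θ (p * q) = θ p * θ q)
    (hone : θ 1 = ε) (p : P) (k : ι) (M : Matrix ι ι P) :
    θ p * single (t k)⁻¹ 1 * matrixMap t θ M = ∑ j, θ (p * M k j) * single (t j)⁻¹ 1 := by
  have hr : ∀ p, θ p * ε = θ p := fun p => by rw [← hone, ← hmul, mul_one]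
  have hl : ∀ p, ε * θ p = θ p := fun p => by rw [← hone, ← hmul, one_mul]
  rw [matrixMap_apply, Finset.mul_sum, Finset.sum_eq_single k]
  · rw [Finset.mul_sum]
    refine Finset.sum_congr rfl fun j _ => ?_
    rw [← mul_assoc, ← mul_assoc, mul_assoc (θ p), single_inv_mul_single, mul_one, hmul]
  · intro i _ hi
    rw [Finset.mul_sum]
    refine Finset.sum_eq_zero fun j _ => ?_
    have hk : (t k)⁻¹ * t i ∉ E := fun hk => hi (ht.1 (QuotientGroup.eq.mpr hk)).symm
    rw [← hr p, ← hl (M i j)]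
    have h0 := h.mul_conj_of_notMem hk
    calc θ p * ε * single (t k)⁻¹ 1 * (single (t i) 1 * (ε * θ (M i j)) * single (t j)⁻¹ 1)
        = θ p * (ε * single (t k)⁻¹ 1 * single (t i) 1 * ε) * (θ (M i j) * single (t j)⁻¹ 1) := by
          simp only [mul_assoc]
      _ = 0 := by rw [h0, mul_zero, zero_mul]
  · simp

theorem matrixMap_mul (h : HasOrthogonalConjugates E ε)
    (ht : Function.Bijective fun i => (t i : G ⧸ E)) (hmul : ∀ p q, θ (p * q) = θ p * θ q)
    (hone : θ 1 = ε) (M N : Matrix ι ι P) :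
    matrixMap t θ (M * N) = matrixMap t θ M * matrixMap t θ N := by
  rw [matrixMap_apply θ M, Finset.sum_mul, matrixMap_apply]
  refine Finset.sum_congr rfl fun i _ => ?_
  have h1 : ∀ k, single (t i) 1 * θ (M i k) * single (t k)⁻¹ 1 * matrixMap t θ N =
      ∑ j, single (t i) 1 * θ (M i k * N k j) * single (t j)⁻¹ 1 := fun k => by
    rw [mul_assoc (single (t i) 1), mul_assoc (single (t i) 1),
      mul_conj_matrixMap h ht hmul hone, Finset.mul_sum]
    simp only [mul_assoc]
  rw [Finset.sum_mul, Finset.sum_congr rfl fun k _ => h1 k, Finset.sum_comm]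
  refine Finset.sum_congr rfl fun j _ => ?_
  rw [Matrix.mul_apply, map_sum, Finset.mul_sum, Finset.sum_mul]

theorem matrixMap_one [DecidableEq ι] (hone : θ 1 = ε) :
    matrixMap t θ (1 : Matrix ι ι P) = conjSum t ε := by
  rw [matrixMap_apply, conjSum]
  refine Finset.sum_congr rfl fun i _ => ?_
  rw [Finset.sum_eq_single i]
  · rw [Matrix.one_apply_eq, hone]
  · intro j _ hj
    rw [Matrix.one_apply_ne hj.symm, map_zero, mul_zero, zero_mul]
  · simp

theorem matrixMap_injective (h : HasOrthogonalConjugates E ε)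
    (ht : Function.Bijective fun i => (t i : G ⧸ E)) (hmul : ∀ p q, θ (p * q) = θ p * θ q)
    (hone : θ 1 = ε) (hinj : Function.Injective θ) : Function.Injective (matrixMap t θ) := by
  have hr : ∀ p, θ p * ε = θ p := fun p => by rw [← hone, ← hmul, mul_one]
  refine (injective_iff_map_eq_zero _).mpr fun M hM => Matrix.ext fun i k => hinj ?_
  have h1 := mul_conj_matrixMap h ht hmul hone 1 i M
  rw [hM, mul_zero] at h1
  have h2 := congrArg (· * (single (t k) 1 * ε)) h1
  simp only [zero_mul, Finset.sum_mul, one_mul] at h2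
  rw [Finset.sum_eq_single k] at h2
  · rw [← mul_assoc, mul_assoc (θ _), single_inv_mul_single, mul_one, hr] at h2
    rw [Matrix.zero_apply, map_zero, ← h2]
  · intro j _ hj
    have hk : (t j)⁻¹ * t k ∉ E := fun hk => hj (ht.1 (QuotientGroup.eq.mpr hk))
    rw [← hr, mul_assoc, mul_assoc, ← mul_assoc (single _ 1), ← mul_assoc ε, ← mul_assoc ε,
      h.mul_conj_of_notMem hk, mul_zero]
  · simp

theorem exists_matrixMap_eq
    (ht : Function.Bijective fun i => (t i : G ⧸ E))
    (hsurj : ∀ g ∈ E, ∃ p, θ p = single g 1 * ε) (z : MonoidAlgebra F G) :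
    ∃ M : Matrix ι ι P, matrixMap t θ M = z * conjSum t ε := by
  classical
  change z * conjSum t ε ∈ LinearMap.range (matrixMap t θ)
  induction z using MonoidAlgebra.induction_linear with
  | zero => simp
  | add f g hf hg =>
    rw [add_mul]
    exact add_mem hf hg
  | single g c =>
    rw [show single g c = c • single g (1 : F) by simp, smul_mul_assoc]
    refine Submodule.smul_mem _ _ ?_
    rw [conjSum, Finset.mul_sum]
    refine Submodule.sum_mem _ fun i _ => ?_
    obtain ⟨j, hj⟩ := ht.2 (g * t i : G)
    obtain ⟨p, hp⟩ := hsurj _ (QuotientGroup.eq.mp hj)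
    refine ⟨Matrix.single j i p, ?_⟩
    rw [matrixMap_single, hp, ← mul_assoc (single (t j) 1), single_mul_single_one,
      mul_inv_cancel_left, ← single_mul_single_one]
    simp only [mul_assoc]

/-- If `θ` identifies an algebra `P` with `ε FG ε`, the component of the central idempotent
`∑ t_i ε t_i⁻¹` is the algebra of matrices over `P`. -/
theorem exists_bijective_component_matrix [DecidableEq ι] (h : HasOrthogonalConjugates E ε)
    (ht : Function.Bijective fun i => (t i : G ⧸ E)) (hmul : ∀ p q, θ (p * q) = θ p * θ q)
    (hone : θ 1 = ε) (hinj : Function.Injective θ)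
    (hsurj : ∀ g ∈ E, ∃ p, θ p = single g 1 * ε) :
    ∃ f : component F (conjSum t ε) →ₙₐ[F] Matrix ι ι P, Function.Bijective f := by
  have hMinj := matrixMap_injective h ht hmul hone hinj
  have hmem : ∀ M : Matrix ι ι P, ∃ a, matrixMap t θ M = a * conjSum t ε := fun M =>
    ⟨matrixMap t θ M, by rw [← matrixMap_one hone, ← matrixMap_mul h ht hmul hone, mul_one]⟩
  have hex : ∀ x : component F (conjSum t ε), ∃ M : Matrix ι ι P, matrixMap t θ M = x := by
    rintro ⟨_, a, rfl⟩
    exact exists_matrixMap_eq ht hsurj a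
  choose g hg using hex
  refine ⟨{ toFun := g, map_smul' := ?_, map_zero' := ?_, map_add' := ?_, map_mul' := ?_ }, ?_, ?_⟩
  · intro c x
    apply hMinj
    simp [hg]
  · apply hMinj
    simp [hg]
  · intro x y
    apply hMinj
    simp [hg]
  · intro x y
    apply hMinj
    simp [hg, matrixMap_mul h ht hmul hone]
  · intro x y hxy
    exact Subtype.ext (by rw [← hg x, ← hg y]; exact congrArg _ hxy)
  · exact fun M => ⟨⟨_, hmem M⟩, hMinj (hg _)⟩

end MatrixComponent

/-! ### Faithful characters and their Galois orbits -/

section Faithful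

variable {F : Type*} [Field F] {G : Type*} [Group G] [Finite G] {H K : Subgroup G}

instance neZero_relIndex : NeZero (K.relIndex H) := ⟨Subgroup.index_ne_zero_of_finite⟩

omit [Finite G] in
theorem FaithfulChar.toHom_eq_one_iff (χ : FaithfulChar F H K) (h : H) :
    χ.toHom h = 1 ↔ (h : G) ∈ K := by
  rw [← MonoidHom.mem_ker, χ.ker_eq, Subgroup.mem_subgroupOf]

theorem epsChar_eq_traceChar (χ : FaithfulChar F H K) : epsChar χ = traceChar χ.toHom 1 := by
  have := Fintype.ofFinite H
  simp only [epsChar, traceChar_apply, one_mul, finsum_eq_sum_of_fintype]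

/-- The image of `χ` is a finite subgroup of the units of a field, hence cyclic; its order is
`[H : K]`. -/
theorem exists_isPrimitiveRoot_generator {L : Type*} [Field L] (χ : H →* Lˣ)
    (hχ : χ.ker = K.subgroupOf H) :
    ∃ y : H, IsPrimitiveRoot (χ y : L) (K.relIndex H) ∧ ∀ x, ∃ i : ℕ, χ x = χ y ^ i := by
  have : Finite χ.range := Finite.of_surjective χ.rangeRestrict χ.rangeRestrict_surjective
  obtain ⟨⟨_, y, rfl⟩, hy⟩ := IsCyclic.exists_monoid_generator (α := χ.range)
  have hgen : ∀ x, ∃ i : ℕ, χ x = χ y ^ i := fun x => by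
    obtain ⟨i, hi⟩ := hy ⟨χ x, x, rfl⟩
    exact ⟨i, (congrArg Subtype.val hi).symm⟩
  refine ⟨y, ?_, hgen⟩
  have hcard : orderOf (χ y) = K.relIndex H := by
    rw [Subgroup.relIndex, ← hχ, Subgroup.index_ker, ← orderOf_eq_card_of_forall_mem_zpowers
      (g := (⟨χ y, y, rfl⟩ : χ.range)) fun x => by
        obtain ⟨i, hi⟩ := hy x
        exact ⟨i, by simpa using hi⟩]
    exact (Subgroup.orderOf_mk _ _).symm
  rw [← hcard]
  exact (IsPrimitiveRoot.orderOf (χ y)).map_of_injective (f := Units.coeHom L) Units.val_injective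

/-- A faithful character generates the group of all characters of a cyclic group. -/
theorem FaithfulChar.exists_pow_eq (χ χ' : FaithfulChar F H K) :
    ∃ r : ℕ, ∀ x, χ'.toHom x = χ.toHom x ^ r := by
  obtain ⟨y, hy, hgen⟩ := exists_isPrimitiveRoot_generator χ.toHom χ.ker_eq
  have hker : ∀ {x}, χ.toHom x = 1 → χ'.toHom x = 1 := fun {x} h =>
    (χ'.toHom_eq_one_iff x).mpr ((χ.toHom_eq_one_iff x).mp h)
  have hy' : (χ'.toHom y : CycField F H K) ^ K.relIndex H = 1 := by
    rw [← Units.val_pow_eq_pow_val, ← map_pow, hker, Units.val_one]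
    rw [map_pow]
    exact Units.ext (by simpa using hy.pow_eq_one)
  obtain ⟨r, _, hr⟩ := hy.eq_pow_of_pow_eq_one hy'
  refine ⟨r, fun x => ?_⟩
  obtain ⟨i, hi⟩ := hgen x
  have h1 : χ'.toHom (x * (y ^ i)⁻¹) = 1 := hker (by rw [map_mul, map_inv, map_pow, hi,
    mul_inv_cancel])
  have hr' : χ'.toHom y = χ.toHom y ^ r := Units.ext (by simpa using hr.symm)
  rw [map_mul, map_inv, mul_inv_eq_one] at h1
  rw [h1, hi, map_pow, hr', ← pow_mul, ← pow_mul, mul_comm]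

/-- Any one character detects membership in `E`, since all faithful characters are powers of it. -/
theorem FaithfulChar.mem_stabE_iff (χ : FaithfulChar F H K) {g : G} (hg : g ∈ biNormalizer H K) :
    g ∈ stabE F H K ↔ ∃ σ : CycField F H K ≃ₐ[F] CycField F H K,
      ∀ x, (conjHom χ.toHom hg.1 x : CycField F H K) = σ (χ.toHom x) := by
  constructor
  · rintro ⟨_, h⟩
    obtain ⟨σ, hσ⟩ := Quotient.exact (h χ.orbit)
    refine ⟨σ, fun x => ?_⟩
    rw [← FaithfulChar.smul_apply, show σ • χ = _ from hσ]
    rfl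
  · rintro ⟨σ, hσ⟩
    refine ⟨hg, fun C => ?_⟩
    induction C using Quotient.inductionOn' with
    | h χ' =>
    obtain ⟨r, hr⟩ := χ.exists_pow_eq χ'
    refine Quotient.sound ⟨σ, ?_⟩
    refine FaithfulChar.ext (MonoidHom.ext fun x => Units.ext ?_)
    change σ (χ'.toHom x : CycField F H K) = χ'.toHom _
    rw [hr, hr, Units.val_pow_eq_pow_val, map_pow, ← hσ]
    rfl

/-- The automorphism of `F(ζ)` induced by conjugation with an element of `E`. -/
theorem FaithfulChar.exists_algEquiv (χ : FaithfulChar F H K) (n : stabE F H K) :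
    ∃ σ : CycField F H K ≃ₐ[F] CycField F H K,
      ∀ a b : H, (b : G) = (n : G)⁻¹ * a * n → σ (χ.toHom a) = χ.toHom b := by
  have hn := inv_mem n.2
  obtain ⟨hg, -⟩ := id hn
  obtain ⟨σ, hσ⟩ := (χ.mem_stabE_iff hg).mp hn
  refine ⟨σ, fun a b hab => ?_⟩
  rw [← hσ]
  exact congrArg (fun x => (χ.toHom x : CycField F H K)) (Subtype.ext (by
    rw [hab]
    exact congrArg ((n : G)⁻¹ * a * ·) (inv_inv (n : G))))

variable [CharZero F]

omit [Finite G] in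
theorem isGalois_cycField : IsGalois F (CycField F H K) :=
  IsCyclotomicExtension.isGalois {K.relIndex H} F _

omit [Finite G] in
theorem finiteDimensional_cycField : FiniteDimensional F (CycField F H K) :=
  IsCyclotomicExtension.finiteDimensional {K.relIndex H} F _

theorem FaithfulChar.adjoin_range (χ : FaithfulChar F H K) :
    Algebra.adjoin F (Set.range fun h => (χ.toHom h : CycField F H K)) = ⊤ := by
  obtain ⟨y, hy, -⟩ := exists_isPrimitiveRoot_generator χ.toHom χ.ker_eq
  rw [eq_top_iff, ← IsCyclotomicExtension.adjoin_primitive_root_eq_top (A := F) hy]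
  exact Algebra.adjoin_mono (by rintro _ rfl; exact ⟨y, rfl⟩)

attribute [local instance] isGalois_cycField finiteDimensional_cycField

variable (χ : FaithfulChar F H K) (h : IsStrongShodaPair H K)

include h

theorem IsStrongShodaPair.mem_biNormalizer {g : G}
    (hg : g ∈ Subgroup.normalizer (K : Set G)) : g ∈ biNormalizer H K :=
  ⟨h.normalizer_le hg, hg⟩

theorem IsStrongShodaPair.hasOrthogonalConjugates :
    HasOrthogonalConjugates (stabE F H K) (traceChar (F := F) χ.toHom 1) where
  idem := by rw [traceChar_mul_traceChar χ.adjoin_range, one_mul]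
  ne_zero := traceChar_one_ne_zero _
  comm g hg := by
    obtain ⟨hg', -⟩ := id hg
    obtain ⟨σ, hσ⟩ := (χ.mem_stabE_iff hg').mp hg
    have := traceChar_mul_single_of_algEquiv hg'.1 hσ 1
    rw [map_one] at this
    exact this.symm
  off g hg := by
    by_cases hn : g ∈ Subgroup.normalizer (K : Set G)
    · have hg' := h.mem_biNormalizer hn
      exact traceChar_mul_single_mul_traceChar_eq_zero hg'.1
        (fun hσ => hg ((χ.mem_stabE_iff hg').mpr hσ)) 1 1
    · exact h.traceChar_mul_single_mul_traceChar χ.toHom_eq_one_iff hn 1 1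

theorem IsStrongShodaPair.eOrbit_eq_conjSum {ι : Type*} [Fintype ι] {t : ι → G}
    (ht : Function.Bijective fun i => (t i : G ⧸ stabE F H K)) :
    eOrbit χ.orbit = conjSum t (traceChar (F := F) χ.toHom 1) := by
  rw [← (h.hasOrthogonalConjugates χ).sum_range_conjBy ht, ← epsChar_eq_traceChar]
  rfl

end Faithful

/-! ### The crossed product of a strong Shoda pair -/

section ShodaSystem

variable {F : Type*} [Field F] [CharZero F] {G : Type*} [Group G] [Finite G] {H K : Subgroup G}

attribute [local instance] isGalois_cycField finiteDimensional_cycField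

omit [CharZero F] [Finite G] in
theorem conj_mem_of_mem_stabE {n : G} (hn : n ∈ stabE F H K) {x : G} (hx : x ∈ H) :
    n⁻¹ * x * n ∈ H := by
  obtain ⟨hg, -⟩ := hn
  exact (Subgroup.mem_normalizer_iff''.mp hg.1 x).mp hx

omit [CharZero F] [Finite G] in
theorem section_mul_mem {φ : EmodH F H K → stabE F H K} (hφ : ∀ x, (φ x : EmodH F H K) = x)
    (x y : EmodH F H K) : (φ (x * y) : G)⁻¹ * φ x * φ y ∈ H := by
  have h1 : (φ (x * y) : EmodH F H K) = (φ x * φ y : stabE F H K) := by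
    rw [hφ, QuotientGroup.mk_mul, hφ, hφ]
  have := mk_eq_iff_inv_mul_mem.mp h1
  rwa [Subgroup.coe_mul, ← mul_assoc] at this

omit [CharZero F] [Finite G] in
theorem FaithfulChar.apply_conj_eq (χ : FaithfulChar F H K) (h x : H) :
    χ.toHom (h⁻¹ * x * h) = χ.toHom x := by
  rw [map_mul, map_mul, mul_right_comm, ← map_mul, inv_mul_cancel, map_one, one_mul]

/-- The action and the twisting are determined by the automorphisms that the elements of `E` induce
on the values of `χ`, and by the values of `χ` on the products `φ(xy)⁻¹ φ(x) φ(y)`. -/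
theorem FaithfulChar.exists_crossedSystem (χ : FaithfulChar F H K)
    {φ : EmodH F H K → stabE F H K} (hφ : ∀ x, (φ x : EmodH F H K) = x) :
    ∃ S : CrossedSystem F (CycField F H K) (EmodH F H K),
      (∀ x (a b : H), (b : G) = (φ x : G)⁻¹ * a * φ x → S.σ x (χ.toHom a) = χ.toHom b) ∧
      ∀ x y, S.τ x y = χ.toHom ⟨_, section_mul_mem hφ x y⟩ := by
  choose σ hσ using χ.exists_algEquiv (F := F)
  refine ⟨⟨fun x => σ (φ x), fun x y => χ.toHom ⟨_, section_mul_mem hφ x y⟩, fun x y a => ?_,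
    fun x y z => ?_⟩, fun x => hσ (φ x), fun x y => rfl⟩
  · have : (σ (φ x)).trans (σ (φ y)) = σ (φ (x * y)) :=
      algEquiv_ext_of_adjoin χ.adjoin_range fun a => by
        let b : H := ⟨_, conj_mem_of_mem_stabE (φ x).2 a.2⟩
        let c : H := ⟨_, conj_mem_of_mem_stabE (φ y).2 b.2⟩
        let d : H := ⟨_, conj_mem_of_mem_stabE (φ (x * y)).2 a.2⟩
        let h : H := ⟨_, section_mul_mem hφ x y⟩
        have hc : c = h⁻¹ * d * h := Subtype.ext (by simp [b, c, d, h]; group)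
        rw [AlgEquiv.trans_apply, hσ _ a b rfl, hσ _ b c rfl, hσ _ a d rfl, hc, χ.apply_conj_eq]
    exact DFunLike.congr_fun this a
  · let h : H := ⟨_, section_mul_mem hφ x y⟩
    rw [hσ (φ z) h ⟨_, conj_mem_of_mem_stabE (φ z).2 h.2⟩ rfl, ← Units.val_mul, ← Units.val_mul,
      ← map_mul, ← map_mul]
    congr 2
    refine Subtype.ext ?_
    simp only [h, Subgroup.coe_mul, mul_assoc x y z]
    group

omit [CharZero F] [Finite G] in
/-- A relation `a K = yⁱ K` in `H / K` becomes `χ(a) = χ(y)ⁱ`. -/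
theorem isShodaSystem_of_apply (χ : FaithfulChar F H K) (y : H)
    {φ : EmodH F H K → stabE F H K} (hφ : ∀ x, (φ x : EmodH F H K) = x)
    {S : CrossedSystem F (CycField F H K) (EmodH F H K)}
    (hσ : ∀ x (a b : H), (b : G) = (φ x : G)⁻¹ * a * φ x → S.σ x (χ.toHom a) = χ.toHom b)
    (hτ : ∀ x x', S.τ x x' = χ.toHom ⟨_, section_mul_mem hφ x x'⟩) :
    IsShodaSystem (χ.toHom y : CycField F H K) y φ S := by
  have key : ∀ (a : H) (i : ℤ), ((a : G) : G ⧸ K) = ((y : G) ^ i : G) →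
      (χ.toHom a : CycField F H K) = (χ.toHom y : CycField F H K) ^ i := fun a i hai => by
    have h1 : χ.toHom (a⁻¹ * y ^ i) = 1 :=
      (χ.toHom_eq_one_iff _).mpr (by simpa using QuotientGroup.eq.mp hai)
    rw [map_mul, map_inv, inv_mul_eq_one, map_zpow] at h1
    rw [h1, Units.val_zpow_eq_zpow_val]
  refine ⟨fun x i hi => ?_, fun x x' j hj => ?_⟩
  · rw [hσ x y ⟨_, conj_mem_of_mem_stabE (φ x).2 y.2⟩ rfl]
    exact key _ i hi
  · rw [hτ]
    exact key _ j hj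

variable {χ : FaithfulChar F H K} (h : IsStrongShodaPair H K)
  {φ : EmodH F H K → stabE F H K} {S : CrossedSystem F (CycField F H K) (EmodH F H K)}

omit [CharZero F] in
theorem traceChar_mul_single_section
    (hσ : ∀ x (a b : H), (b : G) = (φ x : G)⁻¹ * a * φ x → S.σ x (χ.toHom a) = χ.toHom b)
    (x : EmodH F H K) (a : CycField F H K) :
    traceChar (F := F) χ.toHom a * single (φ x : G) 1 =
      single (φ x : G) 1 * traceChar χ.toHom (S.σ x a) := by
  obtain ⟨hg, -⟩ := id (φ x).2
  have h1 : ∀ z : H, (conjHom χ.toHom hg.1 z : CycField F H K) = (S.σ x).symm (χ.toHom z) := by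
    intro z
    rw [AlgEquiv.eq_symm_apply]
    refine hσ x (Subgroup.normalizerMonoidHom H ⟨φ x, hg.1⟩ z) z ?_
    have hz : ((Subgroup.normalizerMonoidHom H ⟨φ x, hg.1⟩ z : H) : G) =
      φ x * z * (φ x : G)⁻¹ := rfl
    rw [hz]
    group
  rw [← traceChar_mul_single_of_algEquiv hg.1 h1, AlgEquiv.symm_apply_apply]

omit [CharZero F] in
theorem single_section_mul_traceChar (hφ : ∀ x, (φ x : EmodH F H K) = x)
    (hτ : ∀ x x', S.τ x x' = χ.toHom ⟨_, section_mul_mem hφ x x'⟩)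
    (x y : EmodH F H K) (a : CycField F H K) :
    single (φ x * φ y : G) (1 : F) * traceChar χ.toHom a =
      single (φ (x * y) : G) 1 * traceChar χ.toHom (S.τ x y * a) := by
  rw [hτ, ← single_mul_traceChar, ← mul_assoc, single_mul_single_one]
  congr 2
  group

include h

omit [CharZero F] in
/-- `E / H` acts faithfully on `F(ζ)`: an element that fixes the values of `χ` centralizes `H / K`.
-/
theorem IsStrongShodaPair.eq_one_of_action_eq_one (hφ : ∀ x, (φ x : EmodH F H K) = x)
    (hσ : ∀ x (a b : H), (b : G) = (φ x : G)⁻¹ * a * φ x → S.σ x (χ.toHom a) = χ.toHom b)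
    {x : EmodH F H K} (hx : S.σ x = 1) : x = 1 := by
  obtain ⟨hg, -⟩ := id (φ x).2
  have hmem : (φ x : G) ∈ H := h.mem_of_commutator_mem hg.2 fun z hz => by
    have hz' : (φ x : G) * z * (φ x : G)⁻¹ ∈ H := (Subgroup.mem_normalizer_iff.mp hg.1 z).mp hz
    have h1 := hσ x ⟨_, hz'⟩ ⟨z, hz⟩ (by group)
    rw [hx, AlgEquiv.one_apply, Units.val_inj] at h1
    have h2 := (χ.toHom_eq_one_iff (⟨_, hz'⟩ * ⟨z, hz⟩⁻¹)).mp (by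
      rw [map_mul, map_inv, h1, mul_inv_cancel])
    exact h2
  rw [← hφ x]
  exact (QuotientGroup.eq_one_iff _).mpr hmem

/-- For a central idempotent `z` the product `z ε_C` is an idempotent of the field `s(L)`, so it is
`0` or `ε_C`. -/
theorem IsStrongShodaPair.isPrimitiveCentralIdempotent_eOrbit (C : CharOrbit F H K) :
    IsPrimitiveCentralIdempotent (eOrbit C) := by
  induction C using Quotient.inductionOn' with
  | h χ =>
  have := Fintype.ofFinite (G ⧸ stabE F H K)
  have ht : Function.Bijective fun q : G ⧸ stabE F H K => (q.out : G ⧸ stabE F H K) := by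
    simp only [QuotientGroup.out_eq']
    exact Function.bijective_id
  have hφ : ∀ x : EmodH F H K, (x.out : EmodH F H K) = x := fun x => x.out_eq'
  obtain ⟨S, hσ, -⟩ := χ.exists_crossedSystem hφ
  have hε := h.hasOrthogonalConjugates χ
  have := hε.isPrimitiveCentralIdempotent ht fun z hz hzz => by
    obtain ⟨a, ha⟩ := exists_mul_traceChar_one_eq hφ χ.adjoin_range hε
      (traceChar_mul_single_section hσ) (fun x => h.eq_one_of_action_eq_one hφ hσ) hz
    have haa : a * a = a := by
      refine sub_eq_zero.mp ((traceChar_eq_zero_iff (F := F) χ.adjoin_range).mp ?_)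
      rw [map_sub, sub_eq_zero, ← traceChar_mul_traceChar χ.adjoin_range, ← ha, mul_assoc,
        ← mul_assoc _ z, ← (hz _).eq, mul_assoc z, hε.idem, ← mul_assoc, hzz]
    rw [ha]
    rcases IsIdempotentElem.iff_eq_zero_or_one.mp haa with rfl | rfl
    · exact Or.inl (map_zero _)
    · exact Or.inr rfl
  rw [← h.eOrbit_eq_conjSum χ ht] at this
  exact this

/-- The component of `e_C` as matrices over the crossed product. They have `[G : E]`
rows because the conjugates of `ε_C` are indexed by `G / E`. -/
theorem IsStrongShodaPair.exists_component_eOrbit_equiv (C : CharOrbit F H K) (y : H)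
    {ζ : CycField F H K}
    (hC : ∃ χ : FaithfulChar F H K, χ.orbit = C ∧ (χ.toHom y : CycField F H K) = ζ)
    (hφ : ∀ x, (φ x : EmodH F H K) = x) :
    ∃ S : CrossedSystem F (CycField F H K) (EmodH F H K), IsShodaSystem ζ y φ S ∧
      ∃ f : component F (eOrbit C) →ₙₐ[F]
        Matrix (Fin (stabE F H K).index) (Fin (stabE F H K).index) S.Product,
      Function.Bijective f := by
  obtain ⟨χ, rfl, rfl⟩ := hC
  obtain ⟨S, hσ, hτ⟩ := χ.exists_crossedSystem hφ
  refine ⟨S, isShodaSystem_of_apply χ y hφ hσ hτ, ?_⟩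
  let e : Fin (stabE F H K).index ≃ G ⧸ stabE F H K := (Finite.equivFin _).symm
  have ht : Function.Bijective fun i => ((e i).out : G ⧸ stabE F H K) := by
    simp only [Quotient.out_eq']
    exact e.bijective
  rw [h.eOrbit_eq_conjSum χ ht]
  have hε := h.hasOrthogonalConjugates χ
  have h1 := traceChar_mul_single_section hσ
  have h2 := single_section_mul_traceChar hφ hτ
  refine exists_bijective_component_matrix (P := S.Product)
    (θ := (crossedEmbedding χ.toHom φ : _ →ₗ[F] MonoidAlgebra F G)) hε ht
    (crossedEmbedding_mulHom χ.adjoin_range h1 h2) (crossedEmbedding_one h2)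
    (crossedEmbedding_injective hφ χ.adjoin_range)
    fun g hg => exists_crossedEmbedding_single_eq hφ hg 1

end ShodaSystem

/-! ### Irreducible complex representations -/

section Irreducible

variable {G : Type*} [Group G] {V : Type*} [AddCommGroup V] [Module ℂ V]
  {ρ : Representation ℂ G V}

theorem exists_asAlgebraHom_apply_eq (hρ : ρ.IsIrreducible) {v : V} (hv : v ≠ 0) (w : V) :
    ∃ z, ρ.asAlgebraHom z v = w := by
  have := (Representation.irreducible_iff_isSimpleModule_asModule ρ).mp hρ
  exact @IsSimpleModule.toSpanSingleton_surjective _ _ _ _ _ this _ hv w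

/-- A central element with eigenvalue `1` acts as the identity on an irreducible representation. -/
theorem asAlgebraHom_eq_one (hρ : ρ.IsIrreducible) {z : MonoidAlgebra ℂ G}
    (hz : ∀ w, Commute z w) {v : V} (hv : v ≠ 0) (hzv : ρ.asAlgebraHom z v = v) :
    ρ.asAlgebraHom z = 1 := by
  ext w
  obtain ⟨a, rfl⟩ := exists_asAlgebraHom_apply_eq hρ hv w
  rw [← Module.End.mul_apply, ← map_mul, (hz a).eq, map_mul, Module.End.mul_apply, hzv,
    Module.End.one_apply]

/-- The group algebra is the sum of its simple left ideals, so one of them is not annihilated by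
`z`. -/
theorem exists_irreducible_apply_ne_zero [Finite G] {z : MonoidAlgebra ℂ G}
    (hz : ∀ w, Commute z w) (h0 : z ≠ 0) :
    ∃ (n : ℕ) (ρ : Representation ℂ G (Fin n → ℂ)), ρ.IsIrreducible ∧ ρ.asAlgebraHom z ≠ 0 := by
  have := Fintype.ofFinite G
  obtain ⟨S, hS, x, hxS, hx⟩ : ∃ S : Submodule (MonoidAlgebra ℂ G) (MonoidAlgebra ℂ G),
      IsSimpleModule (MonoidAlgebra ℂ G) S ∧ ∃ x ∈ S, z * x ≠ 0 := by
    by_contra! hcon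
    let N : Submodule (MonoidAlgebra ℂ G) (MonoidAlgebra ℂ G) :=
      { carrier := {x | z * x = 0}
        add_mem' := fun {a b} ha hb => by
          change z * (a + b) = 0
          rw [mul_add, show z * a = 0 from ha, show z * b = 0 from hb, add_zero]
        zero_mem' := mul_zero z
        smul_mem' := fun a x hx => by
          change z * (a * x) = 0
          rw [← mul_assoc, (hz a).eq, mul_assoc, show z * x = 0 from hx, mul_zero] }
    have htop : (⊤ : Submodule (MonoidAlgebra ℂ G) (MonoidAlgebra ℂ G)) ≤ N := by
      rw [← IsSemisimpleModule.sSup_simples_eq_top (MonoidAlgebra ℂ G) (MonoidAlgebra ℂ G)]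
      exact sSup_le fun S hS x hx => hcon S hS x hx
    have h1 : z * 1 = 0 := htop (Submodule.mem_top (x := (1 : MonoidAlgebra ℂ G)))
    exact h0 (by rwa [mul_one] at h1)
  have hfin : FiniteDimensional ℂ (MonoidAlgebra ℂ G) := inferInstance
  have hfinS : FiniteDimensional ℂ S :=
    FiniteDimensional.of_injective (S.subtype.restrictScalars ℂ) S.subtype_injective
  let e := (Module.finBasis ℂ S).equivFun
  let ρ₀ : Representation ℂ G S := Representation.ofModule' S
  let ρ : Representation ℂ G (Fin (Module.finrank ℂ S) → ℂ) :=
    (e.conjAlgEquiv ℂ : Module.End ℂ S →* _).comp ρ₀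
  have hρ : ∀ (a : MonoidAlgebra ℂ G) (s : S), ρ.asAlgebraHom a (e s) = e (a • s) := fun a s => by
    induction a using MonoidAlgebra.induction_linear with
    | zero => simp
    | add f g hf hg => rw [map_add, LinearMap.add_apply, hf, hg, add_smul, map_add]
    | single g c =>
      have h1 : ρ g (e s) = e (single g (1 : ℂ) • s) := by
        change e (ρ₀ g (e.symm (e s))) = _
        rw [e.symm_apply_apply]
        rfl
      rw [Representation.asAlgebraHom_single, LinearMap.smul_apply, h1, ← map_smul, ← smul_assoc]
      simp
  let E : S ≃ₗ[MonoidAlgebra ℂ G] ρ.asModule :=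
    { e.toAddEquiv with map_smul' := fun a s => (hρ a s).symm }
  refine ⟨_, ρ, (Representation.irreducible_iff_isSimpleModule_asModule ρ).mpr
    (IsSimpleModule.congr E.symm), fun h => hx ?_⟩
  have h1 := hρ z ⟨x, hxS⟩
  rw [h, LinearMap.zero_apply, eq_comm, LinearEquiv.map_eq_zero_iff] at h1
  exact congrArg Subtype.val h1

end Irreducible

/-! ### Induced characters -/

section Induced

variable {G : Type*} [Group G] [Finite G] {H K : Subgroup G} {ψ : H →* ℂˣ}

theorem adjoin_complex_eq_top (s : Set ℂ) : Algebra.adjoin ℂ s = ⊤ := Subsingleton.elim _ _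

/-- Over `ℂ` the Galois group is trivial, and the group `E` of a strong Shoda pair shrinks to `H`.
-/
theorem IsStrongShodaPair.hasOrthogonalConjugates_complex (h : IsStrongShodaPair H K)
    (hψ : ψ.ker = K.subgroupOf H) : HasOrthogonalConjugates H (traceChar (F := ℂ) ψ 1) := by
  have hK : ∀ x : H, ψ x = 1 ↔ (x : G) ∈ K := fun x => by
    rw [← MonoidHom.mem_ker, hψ, Subgroup.mem_subgroupOf]
  refine ⟨?_, traceChar_one_ne_zero ψ, fun g hg => commute_single_traceChar ψ ⟨g, hg⟩ 1,
    fun g hg => ?_⟩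
  · rw [traceChar_mul_traceChar (adjoin_complex_eq_top _), one_mul]
  · by_cases hn : g ∈ Subgroup.normalizer (K : Set G)
    · refine traceChar_mul_single_mul_traceChar_eq_zero (h.normalizer_le hn) ?_ 1 1
      rintro ⟨σ, hσ⟩
      refine hg (h.mem_of_commutator_mem hn fun x hx => ?_)
      have h1 : conjHom ψ (h.normalizer_le hn) ⟨x, hx⟩ = ψ ⟨x, hx⟩ :=
        Units.ext ((hσ _).trans (σ.commutes _))
      refine (hK ((Subgroup.normalizerMonoidHom H ⟨g, h.normalizer_le hn⟩ ⟨x, hx⟩) *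
        ⟨x, hx⟩⁻¹)).mp ?_
      rw [map_mul, map_inv, mul_inv_eq_one]
      exact h1
    · exact h.traceChar_mul_single_mul_traceChar hK hn 1 1

open scoped Classical in
/-- The scalar by which `ε g ε` differs from `ε` is the value at `g` of the extension of `ψ` by
zero; this is the summand of the induced character. -/
theorem mul_single_mul_of_orthogonal (hε : HasOrthogonalConjugates H (traceChar (F := ℂ) ψ 1))
    (g : G) : traceChar (F := ℂ) ψ 1 * single g 1 * traceChar ψ 1 =
      (if hg : g ∈ H then (ψ ⟨g, hg⟩ : ℂ) else 0) • traceChar (F := ℂ) ψ 1 := by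
  split_ifs with hg
  · rw [← (hε.comm g hg).eq, mul_assoc, hε.idem, single_mul_traceChar ψ ⟨g, hg⟩, mul_one,
      ← map_smul, smul_eq_mul, mul_one]
  · rw [hε.off g hg, zero_smul]

variable {V : Type*} [AddCommGroup V] [Module ℂ V] [FiniteDimensional ℂ V]
  {ρ : Representation ℂ G V}

/-- `ε ℂG ε` consists of the scalar multiples of `ε`, so the range of `ρ(ε)` is a line. -/
theorem trace_asAlgebraHom_idempotent (hρ : ρ.IsIrreducible)
    (hε : HasOrthogonalConjugates H (traceChar (F := ℂ) ψ 1))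
    (h0 : ρ.asAlgebraHom (traceChar ψ 1) ≠ 0) :
    LinearMap.trace ℂ V (ρ.asAlgebraHom (traceChar ψ 1)) = 1 := by
  set ε : MonoidAlgebra ℂ G := traceChar ψ 1 with hdef
  have hidem : IsIdempotentElem (ρ.asAlgebraHom ε) := by
    rw [IsIdempotentElem, ← map_mul, hε.idem]
  have hscalar : ∀ z, ∃ c : ℂ, ε * z * ε = c • ε := fun z => by
    induction z using MonoidAlgebra.induction_linear with
    | zero => exact ⟨0, by simp⟩
    | add f g hf hg =>
      obtain ⟨c, hc⟩ := hf
      obtain ⟨d, hd⟩ := hg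
      exact ⟨c + d, by rw [mul_add, add_mul, hc, hd, add_smul]⟩
    | single g c =>
      rw [show single g c = c • single g (1 : ℂ) by simp, mul_smul_comm, smul_mul_assoc,
        mul_single_mul_of_orthogonal hε g, smul_smul]
      exact ⟨_, rfl⟩
  obtain ⟨v, hv⟩ : ∃ v, ρ.asAlgebraHom ε v ≠ 0 := by
    by_contra! hcon
    exact h0 (LinearMap.ext hcon)
  rw [(LinearMap.IsProj.trace ((LinearMap.isProj_range_iff_isIdempotentElem _).mpr hidem)),
    finrank_eq_one_iff_of_nonzero' (⟨ρ.asAlgebraHom ε v, v, rfl⟩ :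
      LinearMap.range (ρ.asAlgebraHom ε)) (fun h => hv (congrArg Subtype.val h)) |>.mpr,
    Nat.cast_one]
  rintro ⟨_, w, rfl⟩
  obtain ⟨z, rfl⟩ := exists_asAlgebraHom_apply_eq hρ hv w
  obtain ⟨c, hc⟩ := hscalar z
  refine ⟨c, Subtype.ext ?_⟩
  change c • ρ.asAlgebraHom ε v = _
  rw [← LinearMap.smul_apply, ← map_smul, ← hc, map_mul, map_mul]
  rfl

/-- If `ψ` is a linear character with kernel `K` for a strong Shoda pair `(H, K)`, an irreducible
representation on which the idempotent of `ψ` does not vanish affords the character `ψ^G`. -/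
theorem IsStrongShodaPair.character_eq_inducedCharacter (h : IsStrongShodaPair H K)
    (hψ : ψ.ker = K.subgroupOf H) (hρ : ρ.IsIrreducible)
    (h0 : ρ.asAlgebraHom (traceChar ψ 1) ≠ 0) (g : G) :
    ρ.character g = inducedCharacter H ψ g := by
  classical
  have := Fintype.ofFinite G
  have hε := h.hasOrthogonalConjugates_complex hψ
  have htr := trace_asAlgebraHom_idempotent hρ hε h0
  set ε : MonoidAlgebra ℂ G := traceChar ψ 1 with hdef
  have hc : (Nat.card H : ℂ) ≠ 0 := Nat.cast_ne_zero.mpr Nat.card_pos.ne'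
  -- `e` is the sum of the different conjugates of `ε`, each of which occurs `|H|` times
  let e : MonoidAlgebra ℂ G := (Nat.card H : ℂ)⁻¹ • ∑ x : G, single x⁻¹ 1 * ε * single x 1
  have hcentral : ∀ w, Commute e w := fun w => by
    refine (commute_of_forall_single fun y => ?_).symm
    refine Commute.smul_right ?_ _
    rw [commute_iff_eq, Finset.mul_sum, Finset.sum_mul]
    refine Fintype.sum_equiv (Equiv.mulRight y⁻¹) _ _ fun x => ?_
    simp only [Equiv.coe_mulRight, mul_inv_rev, inv_inv, mul_assoc, single_mul_single_one,
      inv_mul_cancel, mul_one]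
    rw [← mul_assoc, single_mul_single_one]
  have heε : e * ε = ε := by
    have hx : ∀ x : G, single x⁻¹ 1 * ε * single x 1 * ε = if x ∈ H then ε else 0 := fun x => by
      split_ifs with hx
      · rw [mul_assoc _ ε, ← (hε.comm x hx).eq, ← mul_assoc, single_inv_mul_single, one_mul,
          hε.idem]
      · rw [mul_assoc _ ε, mul_assoc, hε.off x hx, mul_zero]
    rw [smul_mul_assoc, Finset.sum_mul, Finset.sum_congr rfl fun x _ => hx x, ← Finset.sum_filter,
      Finset.sum_const, ← Nat.cast_smul_eq_nsmul ℂ, show (Finset.univ.filter (· ∈ H)).card =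
        Nat.card H by rw [Nat.card_eq_fintype_card, Fintype.card_subtype], inv_smul_smul₀ hc]
  obtain ⟨v, hv⟩ : ∃ v, ρ.asAlgebraHom ε v ≠ 0 := by
    by_contra! hcon
    exact h0 (LinearMap.ext hcon)
  have he1 : ρ.asAlgebraHom e = 1 := asAlgebraHom_eq_one hρ hcentral hv (by
    rw [← Module.End.mul_apply, ← map_mul, heε])
  have hg : ρ g = ρ.asAlgebraHom (e * single g 1) := by
    rw [map_mul, he1, one_mul, Representation.asAlgebraHom_single_one]
  have hterm : ∀ x : G, LinearMap.trace ℂ V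
      (ρ.asAlgebraHom (single x⁻¹ 1 * ε * single x 1 * single g 1)) =
        if hx : x * g * x⁻¹ ∈ H then (ψ ⟨_, hx⟩ : ℂ) else 0 := fun x => by
    have h1 : single x⁻¹ (1 : ℂ) * ε * single x 1 * single g 1 =
        (single x⁻¹ 1 * ε) * (ε * single x 1 * single g 1) := by
      simp only [mul_assoc]
      rw [← mul_assoc ε ε, hε.idem]
    rw [h1, map_mul, LinearMap.trace_mul_comm, ← map_mul]
    have h2 : ε * single x 1 * single g 1 * (single x⁻¹ 1 * ε) =
        ε * single (x * g * x⁻¹) 1 * ε := by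
      rw [← single_mul_single_one, ← single_mul_single_one]
      simp only [mul_assoc]
    rw [h2, mul_single_mul_of_orthogonal hε, map_smul, map_smul, htr, smul_eq_mul, mul_one]
  rw [Representation.character, hg, inducedCharacter, finsum_eq_sum_of_fintype, smul_mul_assoc,
    Finset.sum_mul, map_smul, map_smul, map_sum, map_sum, smul_eq_mul]
  exact congrArg _ (Finset.sum_congr rfl fun x _ => hterm x)

end Induced

/-! ### The primitive central idempotents of a strongly monomial group -/

section Exhaustion

variable {G : Type*} [Group G] [Finite G] {H K : Subgroup G} {ψ : H →* ℂˣ}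

open scoped Classical in
/-- The sum `∑_h ψ(h) ψ°(x h⁻¹ x⁻¹)`, where `ψ°` is the extension of `ψ` by zero, is the sum of the
values of the quotient of two linear characters of `H ∩ x⁻¹ H x`: it is zero or the order of this
group, and the latter for `x = 1`. -/
theorem exists_sum_mul_conj_eq_natCast [Fintype H] (ψ : H →* ℂˣ) (x : G) :
    ∃ n : ℕ, (x = 1 → n ≠ 0) ∧ ∑ h : H, (ψ h : ℂ) *
      (if hx : x * (h : G)⁻¹ * x⁻¹ ∈ H then (ψ ⟨x * (h : G)⁻¹ * x⁻¹, hx⟩ : ℂ) else 0) = n := by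
  let c : H →* G := (MulAut.conj x).toMonoidHom.comp H.subtype
  let M : Subgroup H := H.comap c
  have := Fintype.ofFinite M
  let f : M →* ℂˣ := (ψ.comp M.subtype) * (ψ.comp (c.subgroupComap H))⁻¹
  have hmem : ∀ h : H, h ∈ M ↔ x * (h : G)⁻¹ * x⁻¹ ∈ H := fun h => by
    rw [← inv_mem_iff]
    rfl
  have hsum : ∑ h : H, (ψ h : ℂ) *
      (if hx : x * (h : G)⁻¹ * x⁻¹ ∈ H then (ψ ⟨x * (h : G)⁻¹ * x⁻¹, hx⟩ : ℂ) else 0) =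
        ∑ m : M, (f m : ℂ) := by
    rw [← Finset.sum_filter_of_ne (p := (· ∈ M)), Finset.sum_subtype (p := (· ∈ M)) _ (by simp)]
    · refine Finset.sum_congr rfl fun m _ => ?_
      rw [dif_pos ((hmem m).mp m.2), ← Units.val_mul]
      congr 1
      change _ = ψ m * (ψ (c.subgroupComap H m))⁻¹
      rw [← map_inv]
      congr 2
      refine Subtype.ext ?_
      change x * ((m : H) : G)⁻¹ * x⁻¹ = (x * ((m : H) : G) * x⁻¹)⁻¹
      group
    · intro h _ hne
      by_contra hh
      rw [dif_neg fun hx => hh ((hmem h).mpr hx), mul_zero] at hne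
      exact hne rfl
  rw [hsum]
  by_cases hf : f = 1
  · refine ⟨Nat.card M, fun _ => Nat.card_pos.ne', ?_⟩
    simp [hf]
  · refine ⟨0, ?_, by rw [sum_units_hom_eq_zero hf, Nat.cast_zero]⟩
    rintro rfl
    refine absurd (MonoidHom.ext fun m => ?_) hf
    change ψ m * (ψ (c.subgroupComap H m))⁻¹ = 1
    rw [mul_inv_eq_one]
    congr 1
    refine Subtype.ext ?_
    change ((m : H) : G) = 1 * ((m : H) : G) * 1⁻¹
    group

/-- The idempotent of `ψ` does not vanish on a representation that affords `ψ^G`: its trace is a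
positive multiple of a sum of natural numbers, one of which is not zero. -/
theorem asAlgebraHom_traceChar_ne_zero {V : Type*} [AddCommGroup V] [Module ℂ V]
    {ρ : Representation ℂ G V} (hρ : ∀ g, ρ.character g = inducedCharacter H ψ g) :
    ρ.asAlgebraHom (traceChar ψ 1) ≠ 0 := fun h0 => by
  classical
  have := Fintype.ofFinite G
  choose n hn hsum using exists_sum_mul_conj_eq_natCast ψ
  have hc : (Nat.card H : ℂ) ≠ 0 := Nat.cast_ne_zero.mpr Nat.card_pos.ne'
  have h1 : LinearMap.trace ℂ V (ρ.asAlgebraHom (traceChar ψ 1)) =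
      (Nat.card H : ℂ)⁻¹ * ((Nat.card H : ℂ)⁻¹ * ((∑ x, n x : ℕ) : ℂ)) := by
    have h2 : ((∑ x, n x : ℕ) : ℂ) = ∑ h : H, ∑ x : G, (ψ h : ℂ) *
        (if hx : x * (h : G)⁻¹ * x⁻¹ ∈ H then (ψ ⟨x * (h : G)⁻¹ * x⁻¹, hx⟩ : ℂ) else 0) := by
      rw [Nat.cast_sum, Finset.sum_comm]
      exact Finset.sum_congr rfl fun x _ => (hsum x).symm
    rw [traceChar_apply, map_smul, map_smul, smul_eq_mul, map_sum, map_sum, h2]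
    congr 1
    rw [Finset.mul_sum]
    refine Finset.sum_congr rfl fun h _ => ?_
    rw [Representation.asAlgebraHom_single, map_smul, Algebra.trace_self_apply, one_mul,
      smul_eq_mul, show LinearMap.trace ℂ V (ρ (h : G)⁻¹) = _ from hρ _, inducedCharacter,
      finsum_eq_sum_of_fintype, mul_left_comm, Finset.mul_sum]
  rw [h0, map_zero, eq_comm, mul_eq_zero, mul_eq_zero] at h1
  have h2 : ∑ x, n x = 0 := by
    rcases h1 with h1 | h1 | h1
    · exact absurd h1 (inv_ne_zero hc)
    · exact absurd h1 (inv_ne_zero hc)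
    · exact_mod_cast h1
  exact hn 1 rfl (Finset.sum_eq_zero_iff.mp h2 1 (Finset.mem_univ 1))

/-- `e e'` is a central idempotent below both `e` and `e'`, so it equals both. -/
theorem IsPrimitiveCentralIdempotent.eq_of_mul_ne_zero {R : Type*} [Ring R] {e e' : R}
    (he : IsPrimitiveCentralIdempotent e) (he' : IsPrimitiveCentralIdempotent e')
    (h : e * e' ≠ 0) : e = e' := by
  have key : ∀ {a b : R}, IsPrimitiveCentralIdempotent a → IsPrimitiveCentralIdempotent b →
      a * b ≠ 0 → a = a * b := fun {a b} ha hb hab => by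
    have hcomm : a * b = b * a := (Semigroup.mem_center_iff.mp ha.central b).symm
    have haa : a * a = a := ha.idem
    have hbb : b * b = b := hb.idem
    have h1 : a * b * (a * b) = a * b := by
      rw [mul_assoc, ← mul_assoc b, ← hcomm, mul_assoc a b b, hbb, ← mul_assoc, haa]
    have h2 : a * b * a = a * b := by rw [mul_assoc, ← hcomm, ← mul_assoc, haa]
    have h3 : a * (a * b) = a * b := by rw [← mul_assoc, haa]
    refine sub_eq_zero.mp ((ha.primitive (a * b) (a - a * b) h1 ?_ ?_ ?_ ?_ ?_).resolve_left hab)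
    · rw [IsIdempotentElem, mul_sub, sub_mul, sub_mul, haa, h1, h2, h3, sub_self, sub_zero]
    · exact Set.mul_mem_center ha.central hb.central
    · exact (Subring.center R).sub_mem ha.central
        (Set.mul_mem_center ha.central hb.central)
    · rw [mul_sub, h2, h1, sub_self]
    · rw [add_sub_cancel]
  have hcomm : e * e' = e' * e := (Semigroup.mem_center_iff.mp he.central e').symm
  rw [key he he' h, hcomm, ← key he' he (hcomm ▸ h)]

variable {F : Type*} [Field F] [CharZero F]

attribute [local instance] isGalois_cycField finiteDimensional_cycField

/-- A complex character with kernel `K` takes values in the image of `F(ζ)`. -/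
theorem exists_faithfulChar_of_embedding (hψ : ψ.ker = K.subgroupOf H) (τ : CycField F H K →+* ℂ) :
    ∃ χ : FaithfulChar F H K, ∀ x, τ (χ.toHom x) = ψ x := by
  obtain ⟨y, hy, hgen⟩ := exists_isPrimitiveRoot_generator ψ hψ
  obtain ⟨ζ, hζ⟩ := IsCyclotomicExtension.exists_isPrimitiveRoot F (CycField F H K)
    (Set.mem_singleton (K.relIndex H)) (NeZero.ne _)
  obtain ⟨j, _, hj⟩ := (hζ.map_of_injective (f := τ) τ.injective).eq_pow_of_pow_eq_one hy.pow_eq_one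
  have hinj : Function.Injective (Units.map (τ : CycField F H K →* ℂ)) :=
    Units.map_injective τ.injective
  have hex : ∀ x, ∃ u, Units.map (τ : CycField F H K →* ℂ) u = ψ x := fun x => by
    obtain ⟨i, hi⟩ := hgen x
    refine ⟨((hζ.isUnit (NeZero.ne _)).unit ^ j) ^ i, ?_⟩
    rw [map_pow, hi]
    congr 1
    refine Units.ext ?_
    simpa using hj
  choose u hu using hex
  refine ⟨⟨MonoidHom.mk' u fun a b => hinj (by rw [map_mul, hu, hu, hu, map_mul]), ?_⟩,
    fun x => congrArg Units.val (hu x)⟩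
  rw [← hψ]
  ext x
  rw [MonoidHom.mem_ker, MonoidHom.mem_ker, ← hu x, MonoidHom.mk'_apply, map_eq_one_iff _ hinj]

/-- In `ℂG`, the image of `ε_C` is the sum of the idempotents of the Galois conjugates of `ψ`, one
of which is `ψ` itself. -/
theorem map_traceChar_mul_traceChar (χ : FaithfulChar F H K) (f : F →+* ℂ)
    (τ : CycField F H K →+* ℂ) (hτ : ∀ a, τ (algebraMap F _ a) = f a)
    (hχ : ∀ x, τ (χ.toHom x) = ψ x) :
    mapRingHom G f (traceChar χ.toHom 1) * traceChar ψ 1 = traceChar ψ 1 := by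
  classical
  have := Fintype.ofFinite H
  let χσ : (CycField F H K ≃ₐ[F] CycField F H K) → (H →* ℂˣ) := fun σ =>
    (Units.map ((τ : CycField F H K →* ℂ).comp (σ : CycField F H K →* CycField F H K))).comp χ.toHom
  have hval : ∀ σ h, (χσ σ h : ℂ) = τ (σ (χ.toHom h)) := fun σ h => rfl
  have h1 : mapRingHom G f (traceChar χ.toHom 1) = ∑ σ, traceChar (F := ℂ) (χσ σ) 1 := by
    simp only [traceChar_apply, mapRingHom_smul, map_sum, mapRingHom_single, one_mul,
      Algebra.trace_self_apply,
      hval, ← Finset.smul_sum, map_inv₀, map_natCast]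
    rw [Finset.sum_comm]
    congr 1
    refine Finset.sum_congr rfl fun h _ => ?_
    rw [← hτ, trace_eq_sum_automorphisms, map_sum]
    ext g
    simp [Finsupp.single_apply, Finsupp.finsetSum_apply]
  rw [h1, Finset.sum_mul, Finset.sum_eq_single 1]
  · have : χσ 1 = ψ := MonoidHom.ext fun x => Units.ext (hχ x)
    rw [this, traceChar_mul_traceChar (adjoin_complex_eq_top _), one_mul]
  · intro σ _ hσ
    rw [traceChar_mul_traceChar_of_galois, Finset.sum_eq_zero, zero_mul, map_zero]
    intro s _
    refine if_neg fun hs => hσ (algEquiv_ext_of_adjoin χ.adjoin_range fun x => τ.injective ?_)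
    have hs' : s (χσ σ x : ℂ) = χσ σ x := s.commutes _
    rw [← hval, ← hs', hs x, ← hχ]
    rfl
  · simp

theorem exists_eq_eOrbit [NumberField F] (hG : IsStronglyMonomial G) {e : MonoidAlgebra F G}
    (he : IsPrimitiveCentralIdempotent e) :
    ∃ H K : Subgroup G, IsStrongShodaPair H K ∧ ∃ C : CharOrbit F H K, e = eOrbit C := by
  obtain ⟨f⟩ : Nonempty (F →+* ℂ) := inferInstance
  set m := mapRingHom G f with hm
  have hinj : Function.Injective m := map_injective (f : F →+ ℂ) f.injective
  have hcentral : ∀ w, Commute (m e) w := fun w =>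
    (commute_of_forall_single fun g => by
      have := Semigroup.mem_center_iff.mp he.central (single g (1 : F))
      have := congrArg m this
      rw [map_mul, map_mul, hm, mapRingHom_single, map_one] at this
      exact this).symm
  obtain ⟨n, ρ, hρ, h0⟩ := exists_irreducible_apply_ne_zero hcentral
    ((map_ne_zero_iff m hinj).mpr he.ne_zero)
  obtain ⟨H, K, ψ, hHK, hψ, hchar⟩ := hG n ρ hρ
  have hψ0 := asAlgebraHom_traceChar_ne_zero hchar
  let := f.toAlgebra
  let τ : CycField F H K →ₐ[F] ℂ := IsAlgClosed.lift
  obtain ⟨χ, hχ⟩ := exists_faithfulChar_of_embedding hψ (τ : CycField F H K →+* ℂ)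
  have hmul := map_traceChar_mul_traceChar χ f (τ : CycField F H K →+* ℂ) τ.commutes hχ
  refine ⟨H, K, hHK, χ.orbit, he.eq_of_mul_ne_zero (hHK.isPrimitiveCentralIdempotent_eOrbit _)
    fun hz => hψ0 ?_⟩
  have hone : ρ.asAlgebraHom (m e) = 1 := by
    obtain ⟨v, hv⟩ : ∃ v, ρ.asAlgebraHom (m e) v ≠ 0 := by
      by_contra! hcon
      exact h0 (LinearMap.ext hcon)
    refine asAlgebraHom_eq_one hρ hcentral hv ?_
    rw [← Module.End.mul_apply, ← map_mul, ← map_mul, he.idem.eq]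
  have hε := hHK.hasOrthogonalConjugates χ
  have ht : Function.Bijective fun q : G ⧸ stabE F H K => (q.out : G ⧸ stabE F H K) := by
    simp only [QuotientGroup.out_eq']
    exact Function.bijective_id
  have := Fintype.ofFinite (G ⧸ stabE F H K)
  have hsum : eOrbit χ.orbit * traceChar (F := F) χ.toHom 1 = traceChar χ.toHom 1 := by
    rw [hHK.eOrbit_eq_conjSum χ ht, ← (hε.commute_conjSum ht _).eq, hε.mul_conjSum_self ht]
  have h1 : m e * traceChar ψ 1 = 0 := by
    rw [← hmul, ← hsum, map_mul, ← mul_assoc, ← mul_assoc, ← hm, ← map_mul, hz, map_zero, zero_mul,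
      zero_mul]
  rw [← one_mul (ρ.asAlgebraHom _), ← hone, ← map_mul, h1, map_zero]

end Exhaustion

/-! ### Chains of normal subgroups -/

section Chains

variable {G : Type*} [Group G]

/-- A subgroup of `N⟨z⟩` is generated by one element and its intersection with `N`. -/
theorem exists_generator_modulo (C N : Subgroup G) [N.Normal] (z : G) :
    ∃ x ∈ C ⊓ (N ⊔ Subgroup.zpowers z), ∀ c ∈ C ⊓ (N ⊔ Subgroup.zpowers z),
      ∃ i : ℤ, c * x ^ i ∈ N := by
  set D := C ⊓ (N ⊔ Subgroup.zpowers z)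
  have hle : D.map (QuotientGroup.mk' N) ≤ Subgroup.zpowers (QuotientGroup.mk' N z) := by
    refine (Subgroup.map_mono inf_le_right).trans ?_
    rw [Subgroup.map_sup, MonoidHom.map_zpowers, sup_le_iff]
    refine ⟨?_, le_rfl⟩
    rintro _ ⟨y, hy, rfl⟩
    have h1 : QuotientGroup.mk' N y = 1 := (QuotientGroup.eq_one_iff y).mpr hy
    rw [h1]
    exact one_mem _
  have hcyc : IsCyclic (D.map (QuotientGroup.mk' N)) := Subgroup.isCyclic_of_le hle
  obtain ⟨⟨_, x, hx, rfl⟩, hgen⟩ := hcyc.exists_generator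
  refine ⟨x, hx, fun c hc => ?_⟩
  obtain ⟨i, hi⟩ := hgen ⟨_, c, hc, rfl⟩
  refine ⟨-i, ?_⟩
  rw [← QuotientGroup.eq_one_iff, QuotientGroup.mk_mul, QuotientGroup.mk_zpow, zpow_neg,
    mul_inv_eq_one]
  exact (congrArg Subtype.val hi).symm

/-- If `A < C` are normalized by `T` and `A` contains the bottom of a chain of normal subgroups with
cyclic factors that ends at `G`, then `C` contains a subgroup that is normalized by `T` and
generated by `A` and one further element: intersect `C` with the first member of the chain for which
the intersection is not contained in `A`. -/
theorem exists_normalized_extension {n : ℕ} {N : ℕ → Subgroup G} (hn : N n = ⊤)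
    (hnormal : ∀ i, (N i).Normal) (hstep : ∀ i < n, ∃ x, N (i + 1) = N i ⊔ Subgroup.zpowers x)
    {A C T : Subgroup G} (h0 : N 0 ≤ A) (hCA : ¬ C ≤ A)
    (hTA : T ≤ Subgroup.normalizer (A : Set G)) (hTC : T ≤ Subgroup.normalizer (C : Set G)) :
    ∃ x ∈ C, x ∉ A ∧ T ≤ Subgroup.normalizer ((A ⊔ Subgroup.zpowers x : Subgroup G) : Set G) := by
  classical
  have hex : ∃ i, ¬ C ⊓ N i ≤ A := ⟨n, by rwa [hn, inf_top_eq]⟩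
  obtain ⟨j, hj⟩ : ∃ j, Nat.find hex = j + 1 := Nat.exists_eq_succ_of_ne_zero fun h => by
    have := Nat.find_spec hex
    rw [h] at this
    exact this (inf_le_right.trans h0)
  have hjn : j < n := by
    have := Nat.find_min' hex (show ¬ C ⊓ N n ≤ A by rwa [hn, inf_top_eq])
    omega
  have hNj : C ⊓ N j ≤ A := not_not.mp (Nat.find_min hex (show j < Nat.find hex by omega))
  have hNj' : ¬ C ⊓ N (j + 1) ≤ A := by
    have := Nat.find_spec hex
    rwa [hj] at this
  obtain ⟨z, hz⟩ := hstep j hjn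
  obtain ⟨x, hx, hgen⟩ := exists_generator_modulo C (N j) z
  rw [← hz] at hx hgen
  have hle : C ⊓ N (j + 1) ≤ A ⊔ Subgroup.zpowers x := fun c hc => by
    obtain ⟨i, hi⟩ := hgen c hc
    have h1 : c * x ^ i ∈ A := hNj ⟨C.mul_mem hc.1 (C.zpow_mem hx.1 i), hi⟩
    have h2 := Subgroup.mul_mem _ (Subgroup.mem_sup_left h1 : _ ∈ A ⊔ Subgroup.zpowers x)
      (Subgroup.inv_mem _ (Subgroup.mem_sup_right (Subgroup.zpow_mem_zpowers x i)))
    simpa using h2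
  have heq : A ⊔ Subgroup.zpowers x = A ⊔ (C ⊓ N (j + 1)) :=
    le_antisymm (sup_le le_sup_left ((Subgroup.zpowers_le.mpr hx).trans le_sup_right))
      (sup_le le_sup_left hle)
  refine ⟨x, hx.1, fun hxA => hNj' ?_, ?_⟩
  · refine hle.trans (sup_le le_rfl (Subgroup.zpowers_le.mpr hxA))
  · rw [heq]
    refine (le_inf hTA ?_).trans (Subgroup.normalizer_inf_normalizer_le_normalizer_sup _ _)
    intro t ht
    have h1 := Subgroup.mem_normalizer_iff.mp (hTC ht)
    refine Subgroup.mem_normalizer_iff.mpr fun c => ?_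
    rw [Subgroup.mem_inf, Subgroup.mem_inf, h1 c, (hnormal (j + 1)).mem_comm_iff,
      ← mul_assoc, inv_mul_cancel, one_mul]

/-- The chain of the supersolvable quotient, pulled back to `G`. -/
theorem IsAbelianBySupersolvable.exists_chain (h : IsAbelianBySupersolvable G) :
    ∃ (n : ℕ) (N : ℕ → Subgroup G), (∀ a ∈ N 0, ∀ b ∈ N 0, a * b = b * a) ∧ N n = ⊤ ∧
      (∀ i, (N i).Normal) ∧ ∀ i < n, ∃ x, N (i + 1) = N i ⊔ Subgroup.zpowers x := by
  obtain ⟨A, hA, hcomm, n, N, h0, hn, hnormal, hstep⟩ := h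
  have hker : (QuotientGroup.mk' A).ker = A := QuotientGroup.ker_mk' A
  refine ⟨n, fun i => (N i).comap (QuotientGroup.mk' A), ?_, ?_, fun i => (hnormal i).comap _, ?_⟩
  · simp only [h0, MonoidHom.comap_bot, hker]
    exact fun a ha b hb => congrArg Subtype.val (hcomm.is_comm.comm ⟨a, ha⟩ ⟨b, hb⟩)
  · simp only [hn, Subgroup.comap_top]
  · intro i hi
    obtain ⟨x, hx⟩ := hstep i hi
    obtain ⟨y, rfl⟩ := QuotientGroup.mk'_surjective A x
    refine ⟨y, ?_⟩
    have hmap : ((N i).comap (QuotientGroup.mk' A) ⊔ Subgroup.zpowers y).map (QuotientGroup.mk' A) =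
        N (i + 1) := by
      rw [Subgroup.map_sup, Subgroup.map_comap_eq_self_of_surjective
        (QuotientGroup.mk'_surjective A), MonoidHom.map_zpowers, hx]
    change (N (i + 1)).comap _ = (N i).comap _ ⊔ _
    rw [← hmap, Subgroup.comap_map_eq, hker, sup_eq_left]
    refine le_trans ?_ le_sup_left
    conv_lhs => rw [← hker]
    exact MonoidHom.ker_le_comap _ _

end Chains

/-! ### Lines stabilized by a subgroup -/

section Lines

variable {G : Type*} [Group G] {V : Type*} [AddCommGroup V] [Module ℂ V]

/-- The stabilizer of the line through `v`. -/
def lineStabilizer (ρ : Representation ℂ G V) (v : V) : Subgroup G where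
  carrier := {g | ∃ c : ℂˣ, ρ g v = (c : ℂ) • v}
  one_mem' := ⟨1, by simp⟩
  mul_mem' := by
    rintro a b ⟨c, hc⟩ ⟨d, hd⟩
    exact ⟨c * d, by rw [map_mul, Module.End.mul_apply, hd, map_smul, hc, smul_smul, mul_comm,
      Units.val_mul]⟩
  inv_mem' := by
    rintro a ⟨c, hc⟩
    refine ⟨c⁻¹, ?_⟩
    have h1 := congrArg (fun x => ((c⁻¹ : ℂˣ) : ℂ) • ρ a⁻¹ x) hc
    simpa [smul_smul] using h1.symm

/-- The stabilizer of the vector `v`. -/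
def vectorStabilizer (ρ : Representation ℂ G V) (v : V) : Subgroup G where
  carrier := {g | ρ g v = v}
  one_mem' := by simp
  mul_mem' := by
    intro a b (ha : ρ a v = v) (hb : ρ b v = v)
    change ρ (a * b) v = v
    rw [map_mul, Module.End.mul_apply, hb, ha]
  inv_mem' := by
    intro a (ha : ρ a v = v)
    change ρ a⁻¹ v = v
    conv_lhs => rw [← ha]
    exact ρ.inv_self_apply a v

variable {ρ : Representation ℂ G V} {v : V}

theorem mem_lineStabilizer {g : G} :
    g ∈ lineStabilizer ρ v ↔ ∃ c : ℂˣ, ρ g v = (c : ℂ) • v := Iff.rfl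

theorem mem_vectorStabilizer {g : G} : g ∈ vectorStabilizer ρ v ↔ ρ g v = v := Iff.rfl

/-- A group acts on a line through an abelian quotient. -/
theorem commutator_mem_vectorStabilizer {a b : G} (ha : a ∈ lineStabilizer ρ v)
    (hb : b ∈ lineStabilizer ρ v) : ⁅a, b⁆ ∈ vectorStabilizer ρ v := by
  have ha' := ha
  have hb' := hb
  obtain ⟨c, hc⟩ := ha
  obtain ⟨d, hd⟩ := hb
  have h1 : ρ (b * a) v = ρ (a * b) v := by
    rw [map_mul, map_mul, Module.End.mul_apply, Module.End.mul_apply, hc, hd, map_smul, map_smul,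
      hc, hd, smul_comm]
  obtain ⟨e, he⟩ := inv_mem (s := lineStabilizer ρ v) (mul_mem hb' ha')
  rw [mem_vectorStabilizer, show ⁅a, b⁆ = (a * b) * (b * a)⁻¹ by
    rw [commutatorElement_def, mul_inv_rev, mul_assoc (a * b)], map_mul, Module.End.mul_apply, he,
    map_smul, ← h1, ← map_smul, ← he]
  exact ρ.self_inv_apply _ v

/-- The linear character through which a group acts on a line that it stabilizes. -/
theorem exists_character (hv : v ≠ 0) {A : Subgroup G} (hA : A ≤ lineStabilizer ρ v) :
    ∃ ψ : A →* ℂˣ, (∀ a : A, ρ a v = (ψ a : ℂ) • v) ∧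
      ψ.ker = (A ⊓ vectorStabilizer ρ v).subgroupOf A := by
  choose ψ hψ using fun a : A => mem_lineStabilizer.mp (hA a.2)
  have hinj : ∀ c d : ℂˣ, (c : ℂ) • v = (d : ℂ) • v → c = d := fun c d h =>
    Units.ext (smul_left_injective ℂ hv h)
  refine ⟨MonoidHom.mk' ψ fun a b => hinj _ _ ?_, hψ, ?_⟩
  · rw [← hψ, Subgroup.coe_mul, map_mul, Module.End.mul_apply, hψ, map_smul, hψ, smul_smul,
      mul_comm, Units.val_mul]
  · ext a
    rw [MonoidHom.mem_ker, Subgroup.mem_subgroupOf, Subgroup.mem_inf, mem_vectorStabilizer, hψ]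
    refine ⟨fun h => ⟨a.2, ?_⟩, fun h => hinj _ _ ?_⟩
    · rw [show ψ a = 1 from h, Units.val_one, one_smul]
    · rw [Units.val_one, one_smul]
      exact h.2

/-- The vectors on which `A` acts through the same scalars as on `v` form a space which is stable
under every `x` that commutes with `A` modulo the kernel of this action. An eigenvector of `x` in
this space spans a line stabilized by `A` and by `x`. -/
theorem exists_lineStabilizer_extension [FiniteDimensional ℂ V] (hv : v ≠ 0) {A : Subgroup G}
    (hA : A ≤ lineStabilizer ρ v) {x : G}
    (hx : ∀ a ∈ A, ⁅x⁻¹, a⁆ ∈ A ⊓ vectorStabilizer ρ v) :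
    ∃ w ≠ 0, A ⊔ Subgroup.zpowers x ≤ lineStabilizer ρ w ∧
      A ⊓ vectorStabilizer ρ w = A ⊓ vectorStabilizer ρ v := by
  let W : Submodule ℂ V :=
    { carrier := {w | ∀ a ∈ A, ∀ c : ℂ, ρ a v = c • v → ρ a w = c • w}
      zero_mem' := fun a _ c _ => by rw [map_zero, smul_zero]
      add_mem' := fun {w w'} hw hw' a ha c hc => by
        rw [map_add, hw a ha c hc, hw' a ha c hc, smul_add]
      smul_mem' := fun r w hw a ha c hc => by
        rw [map_smul, hw a ha c hc, smul_comm] }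
  have hvW : v ∈ W := fun a _ c hc => hc
  have hxW : ∀ w ∈ W, ρ x w ∈ W := fun w hw a ha c hc => by
    obtain ⟨hl, hlv⟩ := hx a ha
    have h1 : ρ ⁅x⁻¹, a⁆ w = w := by
      rw [hw _ hl 1 (by rw [one_smul]; exact hlv), one_smul]
    have h2 : a * x = x * ⁅x⁻¹, a⁆ * a := by
      rw [commutatorElement_def]; group
    rw [← Module.End.mul_apply, ← map_mul, h2, map_mul, map_mul, Module.End.mul_apply,
      Module.End.mul_apply, hw a ha c hc, map_smul, map_smul, h1]
  have : Nontrivial W := ⟨⟨⟨v, hvW⟩, 0, fun h => hv (congrArg Subtype.val h)⟩⟩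
  obtain ⟨μ, hμ⟩ := Module.End.exists_eigenvalue ((ρ x).restrict hxW)
  obtain ⟨⟨w, hw⟩, hμw⟩ := hμ.exists_hasEigenvector
  have hw0 : w ≠ 0 := fun h => hμw.2 (Subtype.ext h)
  have hxw : ρ x w = μ • w := congrArg Subtype.val hμw.apply_eq_smul
  have hμ0 : μ ≠ 0 := fun h => hw0 <| by
    rw [← ρ.inv_self_apply x w, hxw, h, zero_smul, map_zero]
  refine ⟨w, hw0, sup_le (fun a ha => ?_) (Subgroup.zpowers_le.mpr ⟨Units.mk0 μ hμ0, hxw⟩), ?_⟩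
  · obtain ⟨c, hc⟩ := hA ha
    exact ⟨c, hw a ha c hc⟩
  · ext a
    refine and_congr_right fun ha => ?_
    obtain ⟨c, hc⟩ := hA ha
    change ρ a w = w ↔ ρ a v = v
    rw [hc, hw a ha c hc]
    have key : ∀ u : V, u ≠ 0 → ((c : ℂ) • u = u ↔ (c : ℂ) = 1) := fun u hu =>
      ⟨fun h => smul_left_injective ℂ hu (by simpa using h), fun h => by rw [h, one_smul]⟩
    rw [key w hw0, key v hv]

/-- An abelian group of operators on a nonzero space has a common eigenvector. -/
theorem exists_le_lineStabilizer_of_commute [Finite G] [FiniteDimensional ℂ V] [Nontrivial V]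
    (ρ : Representation ℂ G V) {B : Subgroup G} (hB : ∀ a ∈ B, ∀ b ∈ B, a * b = b * a) :
    ∃ v ≠ 0, B ≤ lineStabilizer ρ v := by
  obtain ⟨u, hu⟩ := exists_ne (0 : V)
  -- a maximal subgroup of `B` with a common eigenvector is `B`, as it could be extended otherwise
  obtain ⟨A, hA⟩ := exists_maximal_of_wellFoundedGT
    (fun A : Subgroup G => A ≤ B ∧ ∃ v ≠ 0, A ≤ lineStabilizer ρ v) ⟨⊥, bot_le, u, hu, bot_le⟩
  obtain ⟨hAB, v, hv, hAv⟩ := hA.prop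
  refine ⟨v, hv, fun x hx => hAv ?_⟩
  obtain ⟨w, hw, hle, -⟩ := exists_lineStabilizer_extension hv hAv (x := x) fun a ha => by
    rw [commutatorElement_eq_one_iff_mul_comm.mpr (hB _ (inv_mem hx) _ (hAB ha))]
    exact one_mem _
  exact hA.le_of_ge ⟨sup_le hAB (Subgroup.zpowers_le.mpr hx), w, hw, hle⟩ le_sup_left
    (Subgroup.mem_sup_right (Subgroup.mem_zpowers x))

end Lines

/-! ### Strong monomiality of abelian-by-supersolvable groups -/

section Admissible

variable {G : Type*} [Group G] [Finite G] {H K : Subgroup G}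

/-- An element of `N(H)` that does not normalize `K` carries `K` to a subgroup of `H` not contained
in `K`, whose idempotent is annihilated by `ε(H, K)`. -/
theorem eps_mul_conjBy_eq_zero_of_mem_normalizer (hKH : K ≤ H) (hHK : ⁅H, H⁆ ≤ K) {g : G}
    (hgH : g ∈ Subgroup.normalizer (H : Set G)) (hgK : g ∉ Subgroup.normalizer (K : Set G)) :
    eps ℚ H K * conjBy (eps ℚ H K) g = 0 := by
  have hn : H ≤ Subgroup.normalizer (K : Set G) := le_normalizer_of_commutator_le hHK le_rfl hKH
  set M := K.map (MulAut.conj g⁻¹).toMonoidHom with hM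
  have hMH : M ≤ H := by
    rintro _ ⟨k, hk, rfl⟩
    have := (Subgroup.mem_normalizer_iff.mp (inv_mem hgH) k).mp (hKH hk)
    simpa using this
  have hMK : ¬ M ≤ K := fun h => hgK <| by
    have hcard : Nat.card K ≤ Nat.card M :=
      (Subgroup.card_map_of_injective (MulAut.conj g⁻¹).injective).ge
    have heq : M = K := Subgroup.eq_of_le_of_card_ge h hcard
    refine inv_mem_iff.mp (Subgroup.mem_normalizer_iff.mpr fun k => ?_)
    conv_rhs => rw [← heq]
    constructor
    · exact fun hk => ⟨k, hk, by simp⟩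
    · rintro ⟨k', hk', h'⟩
      have : k' = k := (MulAut.conj g⁻¹).injective (by simpa using h')
      exact this ▸ hk'
  have h1 : eps ℚ H K * (single g⁻¹ 1 * hat ℚ K) = 0 := by
    rw [single_mul_hat_map_conj, ← mul_assoc, eps_mul_hat_eq_zero hKH hHK hMH hMK, zero_mul]
  have h2 : hat ℚ K * eps ℚ H K = eps ℚ H K := by
    rw [(commute_hat_eps hn hKH).eq, eps_mul_hat_self hn hKH]
  rw [conjBy, ← h2, ← mul_assoc, ← mul_assoc, ← mul_assoc, h2, mul_assoc _ _ (hat ℚ K), h1,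
    zero_mul, zero_mul]

/-- The elements of `N(L)` that commute with `A` modulo `L`. -/
def centralizerModulo (A L : Subgroup G) : Subgroup G where
  carrier := {g | g ∈ Subgroup.normalizer (L : Set G) ∧ ∀ a ∈ A, ⁅g, a⁆ ∈ L}
  one_mem' := ⟨one_mem _, fun a _ => by rw [commutatorElement_one_left]; exact one_mem _⟩
  mul_mem' := by
    rintro g h ⟨hg, hg'⟩ ⟨hh, hh'⟩
    refine ⟨mul_mem hg hh, fun a ha => ?_⟩
    have h1 := mul_mem ((Subgroup.mem_normalizer_iff.mp hg _).mp (hh' a ha)) (hg' a ha)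
    rwa [show g * ⁅h, a⁆ * g⁻¹ * ⁅g, a⁆ = ⁅g * h, a⁆ by
      simp only [commutatorElement_def]; group] at h1
  inv_mem' := by
    rintro g ⟨hg, hg'⟩
    refine ⟨inv_mem hg, fun a ha => ?_⟩
    have h1 := (Subgroup.mem_normalizer_iff.mp (inv_mem hg) _).mp (inv_mem (hg' a ha))
    rwa [show g⁻¹ * ⁅g, a⁆⁻¹ * g⁻¹⁻¹ = ⁅g⁻¹, a⁆ by
      simp only [commutatorElement_def]; group] at h1

omit [Finite G] in
theorem normalizer_le_normalizer_centralizerModulo {A L : Subgroup G}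
    (h : Subgroup.normalizer (L : Set G) ≤ Subgroup.normalizer (A : Set G)) :
    Subgroup.normalizer (L : Set G) ≤ Subgroup.normalizer (centralizerModulo A L : Set G) := by
  refine Subgroup.le_normalizer_iff.mpr fun t ht g hg => ⟨mul_mem (mul_mem ht hg.1) (inv_mem ht),
    fun a ha => ?_⟩
  have h1 := (Subgroup.mem_normalizer_iff.mp (inv_mem (h ht)) a).mp ha
  have h2 := (Subgroup.mem_normalizer_iff.mp ht _).mp (hg.2 _ h1)
  rwa [show t * ⁅g, t⁻¹ * a * t⁻¹⁻¹⁆ * t⁻¹ = ⁅t * g * t⁻¹, a⁆ by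
    simp only [commutatorElement_def]; group] at h2

variable {V : Type*} [AddCommGroup V] [Module ℂ V] {ρ : Representation ℂ G V} {A : Subgroup G}
  {v : V}

/-- `A` stabilizes the line through `v`, and for the kernel `L` of its action on this line the pair
`(A, L)` has the properties of a strong Shoda pair, with the possible exception of maximality.
The condition `normalizer_le_of_inf_eq` allows `A` to be enlarged: the new kernel meets `A` in `L`.
-/
structure IsAdmissible (ρ : Representation ℂ G V) (A : Subgroup G) (v : V) : Prop where
  ne_zero : v ≠ 0
  le : A ≤ lineStabilizer ρ v
  normalizer_le : Subgroup.normalizer ((A ⊓ vectorStabilizer ρ v : Subgroup G) : Set G) ≤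
    Subgroup.normalizer (A : Set G)
  normalizer_le_of_inf_eq : ∀ X : Subgroup G, X ⊓ A = A ⊓ vectorStabilizer ρ v →
    Subgroup.normalizer (X : Set G) ≤
      Subgroup.normalizer ((A ⊓ vectorStabilizer ρ v : Subgroup G) : Set G)
  orthogonal : ∀ g ∉ Subgroup.normalizer ((A ⊓ vectorStabilizer ρ v : Subgroup G) : Set G),
    eps ℚ A (A ⊓ vectorStabilizer ρ v) * conjBy (eps ℚ A (A ⊓ vectorStabilizer ρ v)) g = 0

omit [Finite G] in
theorem commutator_le_of_le_lineStabilizer (h : A ≤ lineStabilizer ρ v) :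
    ⁅A, A⁆ ≤ A ⊓ vectorStabilizer ρ v :=
  Subgroup.commutator_le.mpr fun _ ha _ hb =>
    ⟨A.mul_mem (A.mul_mem (A.mul_mem ha hb) (A.inv_mem ha)) (A.inv_mem hb),
      commutator_mem_vectorStabilizer (h ha) (h hb)⟩

omit [Finite G] in
theorem normalizer_le_normalizer_inf {X Y : Subgroup G}
    (h : Subgroup.normalizer (X : Set G) ≤ Subgroup.normalizer (Y : Set G)) :
    Subgroup.normalizer (X : Set G) ≤ Subgroup.normalizer ((X ⊓ Y : Subgroup G) : Set G) :=
  Subgroup.le_normalizer_iff.mpr fun _ hg _ hx =>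
    ⟨(Subgroup.mem_normalizer_iff.mp hg _).mp hx.1,
      (Subgroup.mem_normalizer_iff.mp (h hg) _).mp hx.2⟩

theorem isAdmissible_of_normal [A.Normal] (hv : v ≠ 0) (hA : A ≤ lineStabilizer ρ v) :
    IsAdmissible ρ A v where
  ne_zero := hv
  le := hA
  normalizer_le := Subgroup.le_normalizer_of_normal
  normalizer_le_of_inf_eq _ hX := hX ▸ normalizer_le_normalizer_inf Subgroup.le_normalizer_of_normal
  orthogonal g hg := eps_mul_conjBy_eq_zero_of_mem_normalizer inf_le_left
    (commutator_le_of_le_lineStabilizer hA)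
    ((Subgroup.le_normalizer_of_normal (K := ⊤)) (Subgroup.mem_top g)) hg

/-- The line through `v` is replaced by one on which `A` acts through the same scalars and which is
stabilized by `x` too. -/
theorem IsAdmissible.extend [FiniteDimensional ℂ V] (h : IsAdmissible ρ A v) {x : G}
    (hx : x ∈ centralizerModulo A (A ⊓ vectorStabilizer ρ v))
    (hn : Subgroup.normalizer ((A ⊓ vectorStabilizer ρ v : Subgroup G) : Set G) ≤
      Subgroup.normalizer ((A ⊔ Subgroup.zpowers x : Subgroup G) : Set G)) :
    ∃ w, IsAdmissible ρ (A ⊔ Subgroup.zpowers x) w := by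
  obtain ⟨w, hw, hle, hinf⟩ := exists_lineStabilizer_extension h.ne_zero h.le (inv_mem hx).2
  set L := A ⊓ vectorStabilizer ρ v
  set B := A ⊔ Subgroup.zpowers x
  set M := B ⊓ vectorStabilizer ρ w with hM
  have hAB : A ≤ B := le_sup_left
  have hLA : L ≤ A := inf_le_left
  have hMA : M ⊓ A = L := by
    rw [← hinf, hM, inf_right_comm, inf_eq_right.mpr hAB]
  have hLM : L ≤ M := hMA ▸ inf_le_left
  have hcB : ⁅B, B⁆ ≤ M := commutator_le_of_le_lineStabilizer hle
  have hBM : B ≤ Subgroup.normalizer (M : Set G) :=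
    le_normalizer_of_commutator_le hcB le_rfl inf_le_left
  refine ⟨w, hw, hle, (h.normalizer_le_of_inf_eq M hMA).trans hn, fun X hX => ?_, fun g hg => ?_⟩
  · have h1 : X ⊓ A = L := by
      rw [← hMA, hM, ← hX, inf_assoc, inf_eq_right.mpr hAB]
    rw [← hX]
    exact normalizer_le_normalizer_inf ((h.normalizer_le_of_inf_eq X h1).trans hn)
  · by_cases hgL : g ∈ Subgroup.normalizer (L : Set G)
    · exact eps_mul_conjBy_eq_zero_of_mem_normalizer inf_le_left hcB (hn hgL) hg
    · -- outside `N(L)` the orthogonality is inherited, as `ε(B, M)` is a multiple of `ε(A, L)`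
      -- a subgroup `P` of `A` with `L < P` is not contained in `M`, because `M ⊓ A = L`
      have h1 : eps ℚ B M * eps ℚ A L = eps ℚ B M := by
        refine mul_eps_eq_self ?_ fun P hP => eps_mul_hat_eq_zero inf_le_left hcB
          (hP.prop.2.1.trans hAB) fun hPM => hP.prop.1.not_ge ?_
        · rw [← eps_mul_hat_self hBM inf_le_left, mul_assoc, hat_mul_hat_of_ge hLM]
        · exact hMA ▸ le_inf hPM hP.prop.2.1
      have h2 : eps ℚ A L * eps ℚ B M = eps ℚ B M := by
        rw [← (commute_eps (commute_hat_eps hBM (hLA.trans hAB)).symm fun P hP =>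
          (commute_hat_eps hBM (hP.prop.2.1.trans hAB)).symm).eq, h1]
      have h3 := h.orthogonal g hgL
      have h4 : eps ℚ B M * conjBy (eps ℚ B M) g =
          eps ℚ B M * (eps ℚ A L * conjBy (eps ℚ A L) g) *
            (single g⁻¹ 1 * eps ℚ B M * single g 1) := by
        have h5 : single g (1 : ℚ) * single g⁻¹ 1 = 1 := by
          rw [single_mul_single, mul_inv_cancel, mul_one, one_def]
        rw [conjBy, conjBy]
        calc _ = (eps ℚ B M * eps ℚ A L) * single g⁻¹ 1 * (eps ℚ A L * eps ℚ B M) * single g 1 := by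
              rw [h1, h2]; simp only [mul_assoc]
          _ = (eps ℚ B M * eps ℚ A L) * single g⁻¹ 1 * eps ℚ A L * (single g 1 * single g⁻¹ 1) *
                eps ℚ B M * single g 1 := by
              rw [h5, mul_one]; simp only [mul_assoc]
          _ = _ := by simp only [mul_assoc]
      rw [h4, h3, mul_zero, zero_mul]

/-- The idempotent of `ψ` projects onto the vectors on which `A` acts through `ψ`. -/
theorem asAlgebraHom_traceChar_one_apply {ψ : A →* ℂˣ} (hψ : ∀ a : A, ρ a v = (ψ a : ℂ) • v) :
    ρ.asAlgebraHom (traceChar ψ 1) v = v := by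
  have := Fintype.ofFinite A
  have hc : (Nat.card A : ℂ) ≠ 0 := Nat.cast_ne_zero.mpr Nat.card_pos.ne'
  have h1 : ∀ a : A, ρ (a : G)⁻¹ v = ((ψ a)⁻¹ : ℂ) • v := fun a => by
    have := hψ a⁻¹
    rwa [map_inv, Units.val_inv_eq_inv_val] at this
  rw [traceChar_apply, map_smul, map_sum, LinearMap.smul_apply, LinearMap.sum_apply]
  simp only [Representation.asAlgebraHom_single, LinearMap.smul_apply, h1,
    Algebra.trace_self_apply, one_mul, smul_smul]
  simp only [mul_inv_cancel₀ (Units.ne_zero _), one_smul, Finset.sum_const, Finset.card_univ,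
    ← Nat.card_eq_fintype_card]
  rw [← Nat.cast_smul_eq_nsmul ℂ, inv_smul_smul₀ hc]

/-- A maximal admissible subgroup, with the kernel of its action on the line, is a strong Shoda pair
whose linear character affords the given representation. -/
theorem IsAbelianBySupersolvable.isStronglyMonomial (h : IsAbelianBySupersolvable G) :
    IsStronglyMonomial G := by
  intro n ρ hρ
  obtain ⟨m, N, hcomm, hm, hnormal, hstep⟩ := h.exists_chain
  have : Nontrivial (Fin n → ℂ) := by
    have := (Representation.irreducible_iff_isSimpleModule_asModule ρ).mp hρ
    exact IsSimpleModule.nontrivial (MonoidAlgebra ℂ G) ρ.asModule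
  have := hnormal 0
  obtain ⟨u, hu, hN⟩ := exists_le_lineStabilizer_of_commute ρ hcomm
  obtain ⟨A, hA⟩ := exists_maximal_of_wellFoundedGT
    (fun A : Subgroup G => N 0 ≤ A ∧ ∃ v, IsAdmissible ρ A v)
    ⟨N 0, le_rfl, u, isAdmissible_of_normal hu hN⟩
  obtain ⟨h0, v, hv⟩ := hA.prop
  obtain ⟨ψ, hψ, hker⟩ := exists_character hv.ne_zero hv.le
  have hc := commutator_le_of_le_lineStabilizer hv.le
  set L := A ⊓ vectorStabilizer ρ v with hL
  have hAC : A ≤ centralizerModulo A L := fun a ha =>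
    ⟨le_normalizer_of_commutator_le hc le_rfl inf_le_left ha,
      fun b hb => hc (Subgroup.commutator_mem_commutator ha hb)⟩
  have hCA : centralizerModulo A L ≤ A := by
    by_contra hCA
    obtain ⟨x, hx, hxA, hn⟩ := exists_normalized_extension hm hnormal hstep h0 hCA
      hv.normalizer_le (normalizer_le_normalizer_centralizerModulo hv.normalizer_le)
    obtain ⟨w, hw⟩ := hv.extend hx hn
    exact hxA (hA.le_of_ge ⟨h0.trans le_sup_left, w, hw⟩ le_sup_left
      (Subgroup.mem_sup_right (Subgroup.mem_zpowers x)))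
  have hpair : IsStrongShodaPair A L := by
    refine isStrongShodaPair_of_commutator inf_le_left hv.normalizer_le hc ?_
      (fun g hg hgA => hCA ⟨hg, hgA⟩) hv.orthogonal
    obtain ⟨y, -, hy⟩ := exists_isPrimitiveRoot_generator ψ hker
    refine ⟨y, y.2, fun x hx => ?_⟩
    obtain ⟨i, hi⟩ := hy ⟨x, hx⟩
    refine ⟨i, ?_⟩
    have h1 : (⟨x, hx⟩ : A)⁻¹ * y ^ (i : ℤ) ∈ ψ.ker := by
      rw [MonoidHom.mem_ker, map_mul, map_inv, hi, zpow_natCast, map_pow, inv_mul_cancel]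
    rw [hker, Subgroup.mem_subgroupOf] at h1
    simpa using h1
  refine ⟨A, L, ψ, hpair, hker, fun g => hpair.character_eq_inducedCharacter hker hρ ?_ g⟩
  intro h1
  apply hv.ne_zero
  rw [← asAlgebraHom_traceChar_one_apply hψ, h1, LinearMap.zero_apply]

end Admissible

end ShodaPairs

open ShodaPairs in
theorem mainTheorem3 (G : Type*) [Group G] [Finite G] (F : Type*) [Field F] [NumberField F] :
    (IsAbelianBySupersolvable G → IsStronglyMonomial G) ∧
    (IsStronglyMonomial G →
      (∀ e : MonoidAlgebra F G, IsPrimitiveCentralIdempotent e →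
        ∃ H K : Subgroup G, IsStrongShodaPair H K ∧
          ∃ C : CharOrbit F H K, e = eOrbit C) ∧
      (∀ H K : Subgroup G, IsStrongShodaPair H K → ∀ C : CharOrbit F H K,
        IsPrimitiveCentralIdempotent (eOrbit C) ∧
        ∀ ζ : CycField F H K, IsPrimitiveRoot ζ (K.relIndex H) →
        ∀ y : H, (∃ χ : FaithfulChar F H K, χ.orbit = C ∧ (χ.toHom y : CycField F H K) = ζ) →
        ∀ φ : EmodH F H K → stabE F H K, (∀ x, (φ x : EmodH F H K) = x) →
          ∃ S : CrossedSystem F (CycField F H K) (EmodH F H K), IsShodaSystem ζ y φ S ∧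
            ∃ f : component F (eOrbit C) →ₙₐ[F]
                Matrix (Fin (stabE F H K).index) (Fin (stabE F H K).index) S.Product,
              Function.Bijective f)) := by
  refine ⟨IsAbelianBySupersolvable.isStronglyMonomial, fun hG =>
    ⟨fun e he => exists_eq_eOrbit hG he, fun H K hHK C =>
      ⟨hHK.isPrimitiveCentralIdempotent_eOrbit C, fun ζ _ y hC φ hφ =>
        hHK.exists_component_eOrbit_equiv C y hC hφ⟩⟩⟩
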